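/- Let $K$ be an algebraically closed field, $n\ge 0$, and let $\mathbf q=(q_{ij})\in M_n(K^*)$ be multiplicatively antisymmetric, i.e. $q_{ii}=1$ and $q_{ji}=q_{ij}^{-1}$ for all $i,j$. Let $\mathcal O_{\mathbf q}(K^n)$ be the $K$-algebra generated by $x_1,\dots,x_n$ subject only to the relations $x_ix_j=q_{ij}x_jx_i$, and let the quantum torus $\mathbb A_{\mathbf q}$ be the $K$-algebra generated by $x_1^{\pm1},\dots,x_n^{\pm1}$ subject to the same relations. For $a\in K^*$ let $\mathbb A_a$ denote the quantum torus of rank $2$ with generators $x^{\pm1},y^{\pm1}$ and relation $xy=a\,yx$. Suppose that the subgroup $\Lambda$ of $K^*$ generated by all $q_{ij}$ is torsion, and let $m=|\Lambda|$. Then $\Lambda$ is cyclic. For every generator $q$ of $\Lambda$ the quantum torus has a normal form with respect to $q$: there are an integer $s\ge 0$ with $2s\le n$ and positive divisors $1=h_1\mid h_2\mid\cdots\mid h_s$ of $m$, all smaller than $m$ (so $s=0$ if $m=1$), such that $$\mathbb A_{\mathbf q}\;\cong\;\mathbb A_{q^{e_1}}\otimes_K\cdots\otimes_K\mathbb A_{q^{e_s}}\otimes_K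 K[\mathbb Z^{n-2s}]$$ as $K$-algebras, where $e_i=h_i$ for all $i$, except that if $2s=n$ and $s\ge1$ then $e_s=zh_s$ for some $z\in\mathbb N$ with $\operatorname{ord}(q^{zh_s})=\operatorname{ord}(q^{h_s})$. Moreover, there is a surjective map $\Psi$ from $(K^*)^n$ onto the set of isomorphism classes of simple right $\mathcal O_{\mathbf q}(K^n)$-modules on which none of the variables $x_1,\dots,x_n$ acts as zero, such that, for every such normal form, with $k_i:=m/h_i$, $$\dim_K\Psi(\underline\alpha)=\prod_{i=1}^s k_i\qquad\text{for all }\underline\alpha\in(K^*)^n .$$ -/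

import Mathlib

open scoped TensorProduct

universe u

namespace QuantumSpace

/-- The defining relations `x i * x j = q i j * x j * x i` of quantum affine space. -/
inductive AffineRel {K : Type u} [Field K] {n : ℕ} (q : Matrix (Fin n) (Fin n) Kˣ) :
    FreeAlgebra K (Fin n) → FreeAlgebra K (Fin n) → Prop
  | comm (i j : Fin n) :
      AffineRel q (FreeAlgebra.ι K i * FreeAlgebra.ι K j)
        ((q i j : K) • (FreeAlgebra.ι K j * FreeAlgebra.ι K i))

/-- Multiparameter quantum affine `n`-space: the `K`-algebra generated by `x 1, …, x n`
subject only to the relations `x i * x j = q i j * x j * x i`. -/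
abbrev QAffine {K : Type u} [Field K] {n : ℕ} (q : Matrix (Fin n) (Fin n) Kˣ) : Type u :=
  RingQuot (AffineRel q)

/-- The generator `x i` of quantum affine space. -/
noncomputable def QAffine.x {K : Type u} [Field K] {n : ℕ} (q : Matrix (Fin n) (Fin n) Kˣ)
    (i : Fin n) : QAffine q :=
  RingQuot.mkAlgHom K (AffineRel q) (FreeAlgebra.ι K i)

/-- The defining relations of the quantum torus; the letter `Sum.inl i` stands for `x i`
and the letter `Sum.inr i` for its inverse. -/
inductive TorusRel {K : Type u} [Field K] {n : ℕ} (q : Matrix (Fin n) (Fin n) Kˣ) :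
    FreeAlgebra K (Fin n ⊕ Fin n) → FreeAlgebra K (Fin n ⊕ Fin n) → Prop
  | comm (i j : Fin n) :
      TorusRel q (FreeAlgebra.ι K (Sum.inl i) * FreeAlgebra.ι K (Sum.inl j))
        ((q i j : K) • (FreeAlgebra.ι K (Sum.inl j) * FreeAlgebra.ι K (Sum.inl i)))
  | mul_inv (i : Fin n) :
      TorusRel q (FreeAlgebra.ι K (Sum.inl i) * FreeAlgebra.ι K (Sum.inr i)) 1
  | inv_mul (i : Fin n) :
      TorusRel q (FreeAlgebra.ι K (Sum.inr i) * FreeAlgebra.ι K (Sum.inl i)) 1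

/-- The quantum torus of rank `n`: the `K`-algebra generated by `x 1, …, x n` and their
inverses subject only to the relations `x i * x j = q i j * x j * x i`. -/
abbrev QTorus {K : Type u} [Field K] {n : ℕ} (q : Matrix (Fin n) (Fin n) Kˣ) : Type u :=
  RingQuot (TorusRel q)

/-- The quantum torus of rank two with `x * y = a * y * x`. -/
abbrev QTorus₂ {K : Type u} [Field K] (a : Kˣ) : Type u :=
  QTorus (!![1, a; a⁻¹, 1] : Matrix (Fin 2) (Fin 2) Kˣ)

/-- `q` is multiplicatively antisymmetric. -/
def IsMulAntisymm {K : Type u} [Field K] {n : ℕ} (q : Matrix (Fin n) (Fin n) Kˣ) : Prop :=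
  (∀ i, q i i = 1) ∧ ∀ i j, q j i = (q i j)⁻¹

/-- The multiplicative group generated by the parameters `q i j`. -/
def paramGroup {K : Type u} [Field K] {n : ℕ} (q : Matrix (Fin n) (Fin n) Kˣ) : Subgroup Kˣ :=
  Subgroup.closure {a | ∃ i j, q i j = a}

/-- The exponents of the rank two factors in the normal form: these are `h 1, …, h s`, except
that in the case `2 * s = n` the last one is `z * h s`. -/
def normalExp (n : ℕ) {s : ℕ} (h : Fin s → ℕ) (z : ℕ) (i : Fin s) : ℕ :=
  if 2 * s = n ∧ i.val + 1 = s then z * h i else h i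

/-- `(s, h, z)` is a normal form of the quantum torus of `q` with respect to the generator `g`
of the parameter group. The nonzero classes modulo `m` of products of powers of the primes
dividing `m`, with exponents bounded by those in `m`, are represented by the divisors of `m`
smaller than `m`. -/
structure IsNormalForm {K : Type u} [Field K] {n : ℕ} (q : Matrix (Fin n) (Fin n) Kˣ)
    (g : Kˣ) (s : ℕ) (h : Fin s → ℕ) (z : ℕ) : Prop where
  two_mul_le : 2 * s ≤ n
  dvd_card : ∀ i, h i ∣ Nat.card (paramGroup q)
  lt_card : ∀ i, h i < Nat.card (paramGroup q)
  first : ∀ i : Fin s, i.val = 0 → h i = 1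
  chain : ∀ i j : Fin s, i ≤ j → h i ∣ h j
  order_eq : ∀ i : Fin s, orderOf (g ^ normalExp n h z i) = orderOf (g ^ h i)
  iso : Nonempty (QTorus q ≃ₐ[K]
    ((⨂[K] i : Fin s, QTorus₂ (g ^ normalExp n h z i)) ⊗[K]
      AddMonoidAlgebra K (Fin (n - 2 * s) → ℤ)))

/-- A simple right module over quantum affine space (a module over the opposite ring) on which
no variable acts as zero. -/
structure SimpleMod {K : Type u} [Field K] {n : ℕ} (q : Matrix (Fin n) (Fin n) Kˣ) where
  carrier : Type u
  [addCommGroup : AddCommGroup carrier]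
  [module : Module (QAffine q)ᵐᵒᵖ carrier]
  simple : IsSimpleModule (QAffine q)ᵐᵒᵖ carrier
  nontrivial : ∀ i : Fin n, ∃ v : carrier, MulOpposite.op (QAffine.x q i) • v ≠ 0

attribute [instance] SimpleMod.addCommGroup SimpleMod.module

/-- Isomorphism of modules, as an equivalence relation. -/
instance SimpleMod.setoid {K : Type u} [Field K] {n : ℕ} (q : Matrix (Fin n) (Fin n) Kˣ) :
    Setoid (SimpleMod q) where
  r M N := Nonempty (M.carrier ≃ₗ[(QAffine q)ᵐᵒᵖ] N.carrier)
  iseqv :=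
    { refl := fun _ => ⟨LinearEquiv.refl _ _⟩
      symm := fun ⟨e⟩ => ⟨e.symm⟩
      trans := fun ⟨e⟩ ⟨f⟩ => ⟨e.trans f⟩ }

/-- The dimension of a module over the ground field, which acts through the algebra. -/
noncomputable def SimpleMod.dim {K : Type u} [Field K] {n : ℕ}
    {q : Matrix (Fin n) (Fin n) Kˣ} (M : SimpleMod q) : Cardinal.{u} :=
  letI : Module K M.carrier := Module.compHom M.carrier (algebraMap K (QAffine q)ᵐᵒᵖ)
  Module.rank K M.carrier

theorem SimpleMod.dim_eq {K : Type u} [Field K] {n : ℕ}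
    {q : Matrix (Fin n) (Fin n) Kˣ} (M N : SimpleMod q) (hMN : M ≈ N) : M.dim = N.dim := by
  obtain ⟨e⟩ := hMN
  let _ : Module K M.carrier := Module.compHom M.carrier (algebraMap K (QAffine q)ᵐᵒᵖ)
  let _ : Module K N.carrier := Module.compHom N.carrier (algebraMap K (QAffine q)ᵐᵒᵖ)
  let f : M.carrier ≃ₗ[K] N.carrier :=
    { e.toAddEquiv with
      map_smul' := fun c v => e.map_smul (algebraMap K (QAffine q)ᵐᵒᵖ c) v }
  exact f.rank_eq

/-- The set of isomorphism classes of simple right modules on which no variable acts as zero. -/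
abbrev SimpleClass {K : Type u} [Field K] {n : ℕ} (q : Matrix (Fin n) (Fin n) Kˣ) : Type (u + 1) :=
  Quotient (SimpleMod.setoid q)

/-- The dimension over the ground field of an isomorphism class. -/
noncomputable def SimpleClass.dim {K : Type u} [Field K] {n : ℕ}
    {q : Matrix (Fin n) (Fin n) Kˣ} (c : SimpleClass q) : Cardinal.{u} :=
  Quotient.lift SimpleMod.dim SimpleMod.dim_eq c

end QuantumSpace

/-! The parameter group is finitely generated and torsion, hence finite, hence cyclic as a finite
subgroup of `Kˣ`. Fix a generator `g` of order `m` and write the parameters as powers of `g`.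

Replacing `x i` by `x i * x j ^ t` acts on the exponents as a simultaneous row and column operation,
so the normal form is that of an alternating matrix over ℤ/m. An entry of least positive exponent,
taken over all matrices in reach, clears its two rows by division with remainder and divides
whatever is left (`exists_pivot`); induction on the index set yields the blocks and the divisor
chain (`exists_reach_isBlockForm`). When only two indices remain, no operation changes their entry,
and this is the source of the multiplier `z`. The torus of a block matrix is the tensor product
because both have the same universal property (`nonempty_algEquiv_blockTorus`).

On a simple module where no variable acts as zero every variable acts bijectively, so the torus
acts. The `m`-th powers of the variables commute with all variables; Schur's argument, Nakayama's
lemma and Zariski's lemma then give finite dimension (`IsIrreducibleFamily.module_finite`). In block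
form the action consists of scalars and of mutually commuting pairs `X i`, `Y i` with `Y i * X i = ε
i • X i * Y i`, and the powers of `X i` and `Y i` of exponent `orderOf (ε i)` are scalars. Since `X
i` multiplies eigenvalues of `Y i` by `ε i`, a joint eigenvector of the `Y i` exists for any
admissible eigenvalues, and it generates a space of dimension `∏ i, orderOf (ε i)`. This fixes the
dimension, and it shows that the `n` central scalars determine the module. The classes therefore
inject into `(K*)^n`, and Ψ is a left inverse of that injection; it needs one class to exist, which
weighted shift operators provide. -/

namespace QuantumSpace

/-! ### Units that commute up to a scalar -/

section SkewCommuting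

variable {K : Type*} [Field K] {A : Type*} [Semiring A] [Algebra K A]

/-- The units `u` and `v` of a `K`-algebra commute up to the scalar `c`. -/
def SkewCommute (c : Kˣ) (u v : Aˣ) : Prop :=
  u * v = Units.map (algebraMap K A : K →* A) c * (v * u)

theorem units_map_algebraMap_commute (c : Kˣ) (u : Aˣ) :
    Commute (Units.map (algebraMap K A : K →* A) c) u := by
  ext
  exact Algebra.commutes _ _

theorem skewCommute_iff {c : Kˣ} {u v : Aˣ} :
    SkewCommute c u v ↔ (u * v : A) = (c : K) • (v * u : A) := by
  rw [SkewCommute, Units.ext_iff, Algebra.smul_def]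
  rfl

/-- The pairs `(c, u)` such that `u` commutes with `v` up to the scalar `c`. -/
def skewCentralizer (v : Aˣ) : Subgroup (Kˣ × Aˣ) where
  carrier := {p | SkewCommute p.1 p.2 v}
  one_mem' := by simp [SkewCommute]
  mul_mem' := by
    rintro ⟨c, x⟩ ⟨d, y⟩ (h : SkewCommute c x v) (h' : SkewCommute d y v)
    change SkewCommute (c * d) (x * y) v
    unfold SkewCommute at *
    rw [mul_assoc, h', ← mul_assoc x, ← (units_map_algebraMap_commute d x).eq, mul_assoc,
      ← mul_assoc x, h, mul_comm c, map_mul]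
    simp only [mul_assoc]
  inv_mem' := by
    rintro ⟨c, x⟩ (h : SkewCommute c x v)
    change SkewCommute c⁻¹ x⁻¹ v
    unfold SkewCommute at *
    rw [inv_mul_eq_iff_eq_mul, ← mul_assoc x, ← (units_map_algebraMap_commute c⁻¹ x).eq, mul_assoc,
      ← mul_assoc x, h, map_inv]
    group

theorem SkewCommute.mul_left {c d : Kˣ} {u u' v : Aˣ} (h : SkewCommute c u v)
    (h' : SkewCommute d u' v) : SkewCommute (c * d) (u * u') v :=
  (skewCentralizer v).mul_mem (x := (c, u)) (y := (d, u')) h h'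

theorem SkewCommute.zpow_left {c : Kˣ} {u v : Aˣ} (h : SkewCommute c u v) (t : ℤ) :
    SkewCommute (c ^ t) (u ^ t) v :=
  (skewCentralizer v).zpow_mem (x := (c, u)) h t

theorem SkewCommute.symm {c : Kˣ} {u v : Aˣ} (h : SkewCommute c u v) :
    SkewCommute c⁻¹ v u := by
  unfold SkewCommute at *
  rw [h, map_inv]
  group

theorem SkewCommute.mul_right {c d : Kˣ} {u v v' : Aˣ} (h : SkewCommute c u v)
    (h' : SkewCommute d u v') : SkewCommute (c * d) u (v * v') := by
  simpa [mul_comm] using (h.symm.mul_left h'.symm).symm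

theorem SkewCommute.zpow_right {c : Kˣ} {u v : Aˣ} (h : SkewCommute c u v) (t : ℤ) :
    SkewCommute (c ^ t) u (v ^ t) := by
  simpa using (h.symm.zpow_left t).symm

theorem skewCommute_one_iff {u v : Aˣ} : SkewCommute (1 : Kˣ) u v ↔ Commute u v := by
  simp [SkewCommute, Commute, SemiconjBy]

theorem SkewCommute.map {B : Type*} [Semiring B] [Algebra K B] (f : A →ₐ[K] B) {c : Kˣ} {u v : Aˣ}
    (h : SkewCommute c u v) :
    SkewCommute c (Units.map (f : A →* B) u) (Units.map (f : A →* B) v) := by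
  rw [skewCommute_iff] at *
  simpa using congrArg f h

end SkewCommuting

/-! ### Generators and universal property of the quantum torus -/

namespace QTorus

variable {K : Type u} [Field K] {n : ℕ} (q : Matrix (Fin n) (Fin n) Kˣ)

/-- The generator `x i` of the quantum torus, as a unit. -/
noncomputable def x (i : Fin n) : (QTorus q)ˣ where
  val := RingQuot.mkAlgHom K (TorusRel q) (FreeAlgebra.ι K (Sum.inl i))
  inv := RingQuot.mkAlgHom K (TorusRel q) (FreeAlgebra.ι K (Sum.inr i))
  val_inv := by
    rw [← map_mul, RingQuot.mkAlgHom_rel K (TorusRel.mul_inv i), map_one]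
  inv_val := by
    rw [← map_mul, RingQuot.mkAlgHom_rel K (TorusRel.inv_mul i), map_one]

theorem skewCommute_x (i j : Fin n) : SkewCommute (q i j) (x q i) (x q j) := by
  rw [skewCommute_iff]
  simp only [x]
  rw [← map_mul, RingQuot.mkAlgHom_rel K (TorusRel.comm i j), map_smul, map_mul]

variable {q} {A : Type*} [Semiring A] [Algebra K A]

/-- The universal property of the quantum torus. -/
noncomputable def lift (w : Fin n → Aˣ) (h : ∀ i j, SkewCommute (q i j) (w i) (w j)) :
    QTorus q →ₐ[K] A :=
  RingQuot.liftAlgHom K ⟨FreeAlgebra.lift K (Sum.elim (fun i => (w i : A)) fun i => ↑(w i)⁻¹), by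
    rintro _ _ (⟨i, j⟩ | i | i)
    · simpa using skewCommute_iff.mp (h i j)
    · simp
    · simp⟩

@[simp]
theorem lift_x (w : Fin n → Aˣ) (h : ∀ i j, SkewCommute (q i j) (w i) (w j)) (i : Fin n) :
    lift w h (x q i) = w i := by
  simp [lift, x]

@[simp]
theorem map_lift_x (w : Fin n → Aˣ) (h : ∀ i j, SkewCommute (q i j) (w i) (w j)) (i : Fin n) :
    Units.map (lift w h : QTorus q →* A) (x q i) = w i :=
  Units.ext (lift_x w h i)

theorem algHom_ext {f g : QTorus q →ₐ[K] A} (h : ∀ i, f (x q i) = g (x q i)) : f = g := by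
  apply RingQuot.ringQuot_ext'
  apply FreeAlgebra.hom_ext
  funext i
  rcases i with i | i
  · exact h i
  · have : Units.map (f : QTorus q →* A) (x q i) = Units.map (g : QTorus q →* A) (x q i) :=
      Units.ext (h i)
    exact congrArg (fun w : Aˣ => (↑w⁻¹ : A)) this

theorem adjoin_x_eq_top :
    Algebra.adjoin K (Set.range (fun i => (x q i : QTorus q)) ∪
      Set.range (fun i => (↑(x q i)⁻¹ : QTorus q))) = ⊤ := by
  rw [eq_top_iff, ← AlgHom.range_eq_top (RingQuot.mkAlgHom K (TorusRel q)) |>.mpr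
    (RingQuot.mkAlgHom_surjective K _), ← Algebra.map_top, ← FreeAlgebra.adjoin_range_ι,
    AlgHom.map_adjoin]
  apply Algebra.adjoin_mono
  rintro _ ⟨_, ⟨i | i, rfl⟩, rfl⟩
  · exact Or.inl ⟨i, rfl⟩
  · exact Or.inr ⟨i, rfl⟩

end QTorus

theorem QAffine.x_mul_x {K : Type u} [Field K] {n : ℕ} (q : Matrix (Fin n) (Fin n) Kˣ)
    (i j : Fin n) :
    QAffine.x q i * QAffine.x q j = (q i j : K) • (QAffine.x q j * QAffine.x q i) := by
  simp only [QAffine.x]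
  rw [← map_mul, RingQuot.mkAlgHom_rel K (AffineRel.comm i j), map_smul, map_mul]

theorem QAffine.adjoin_x_eq_top {K : Type u} [Field K] {n : ℕ}
    {q : Matrix (Fin n) (Fin n) Kˣ} :
    Algebra.adjoin K (Set.range (QAffine.x q)) = ⊤ := by
  rw [eq_top_iff, ← AlgHom.range_eq_top (RingQuot.mkAlgHom K (AffineRel q)) |>.mpr
    (RingQuot.mkAlgHom_surjective K _), ← Algebra.map_top, ← FreeAlgebra.adjoin_range_ι,
    AlgHom.map_adjoin]
  apply Algebra.adjoin_mono
  rintro _ ⟨_, ⟨i, rfl⟩, rfl⟩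
  exact ⟨i, rfl⟩

/-! ### Elementary changes of generators -/

section Transvection

variable {K : Type u} [Field K] {n : ℕ}

/-- The parameters of the generators obtained from `x` by replacing `x i` by `x i * x j ^ t`. -/
def transvect (q : Matrix (Fin n) (Fin n) Kˣ) (i j : Fin n) (t : ℤ) : Matrix (Fin n) (Fin n) Kˣ :=
  fun a b => q a b * (if a = i then q j b ^ t else 1) * (if b = i then q a j ^ t else 1)

variable {q : Matrix (Fin n) (Fin n) Kˣ} {i j : Fin n}

theorem transvect_of_ne {a b : Fin n} (t : ℤ) (ha : a ≠ i) (hb : b ≠ i) :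
    transvect q i j t a b = q a b := by
  simp [transvect, ha, hb]

theorem transvect_left {b : Fin n} (t : ℤ) (hb : b ≠ i) :
    transvect q i j t i b = q i b * q j b ^ t := by
  simp [transvect, hb]

theorem transvect_right {a : Fin n} (t : ℤ) (ha : a ≠ i) :
    transvect q i j t a i = q a i * q a j ^ t := by
  simp [transvect, ha]

theorem IsMulAntisymm.transvect (hq : IsMulAntisymm q) (t : ℤ) :
    IsMulAntisymm (transvect q i j t) := by
  constructor
  · intro a
    by_cases ha : a = i
    · subst ha
      simp [QuantumSpace.transvect, hq.1, hq.2 a j]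
    · simp [QuantumSpace.transvect, hq.1, ha]
  · intro a b
    simp only [QuantumSpace.transvect]
    rw [hq.2 a b, hq.2 a j, hq.2 j b]
    split_ifs <;> simp [mul_assoc, mul_comm, mul_left_comm]

/-- For `i ≠ j` the generator `x j` is kept, so multiplying `x i` by `x j ^ (-t)` undoes the
substitution. -/
theorem transvect_neg (hq : IsMulAntisymm q) (hij : i ≠ j) (t : ℤ) :
    transvect (transvect q i j t) i j (-t) = q := by
  funext a b
  by_cases ha : a = i <;> by_cases hb : b = i
  · subst ha hb
    rw [(hq.transvect t |>.transvect (-t)).1, hq.1]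
  · subst ha
    rw [transvect_left _ hb, transvect_left _ hb, transvect_of_ne _ hij.symm hb]
    simp
  · subst hb
    rw [transvect_right _ ha, transvect_right _ ha, transvect_of_ne _ ha hij.symm]
    simp
  · rw [transvect_of_ne _ ha hb, transvect_of_ne _ ha hb]

theorem SkewCommute.transvect {A : Type*} [Semiring A] [Algebra K A] {w : Fin n → Aˣ}
    (hq : IsMulAntisymm q) (h : ∀ a b, SkewCommute (q a b) (w a) (w b))
    (t : ℤ) (a b : Fin n) :
    SkewCommute (transvect q i j t a b) (Function.update w i (w i * w j ^ t) a)
      (Function.update w i (w i * w j ^ t) b) := by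
  by_cases ha : a = i <;> by_cases hb : b = i
  · subst ha hb
    rw [(hq.transvect t).1, skewCommute_one_iff]
  · subst ha
    rw [transvect_left _ hb, Function.update_self, Function.update_of_ne hb]
    exact (h _ _).mul_left ((h _ _).zpow_left t)
  · subst hb
    rw [transvect_right _ ha, Function.update_self, Function.update_of_ne ha]
    exact (h _ _).mul_right ((h _ _).zpow_right t)
  · rw [transvect_of_ne _ ha hb, Function.update_of_ne ha, Function.update_of_ne hb]
    exact h _ _

theorem nonempty_algEquiv_transvect (hq : IsMulAntisymm q) (hij : i ≠ j) (t : ℤ) :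
    Nonempty (QTorus q ≃ₐ[K] QTorus (transvect q i j t)) := by
  have hinv := SkewCommute.transvect (i := i) (j := j) (hq.transvect t)
    (QTorus.skewCommute_x (transvect q i j t)) (-t)
  rw [transvect_neg hq hij] at hinv
  let f := QTorus.lift _ hinv
  let g := QTorus.lift _ (SkewCommute.transvect (i := i) (j := j) hq (QTorus.skewCommute_x q) t)
  refine ⟨AlgEquiv.ofAlgHom f g (QTorus.algHom_ext fun a => ?_) (QTorus.algHom_ext fun a => ?_)⟩
  all_goals
    simp only [f, g, AlgHom.comp_apply, AlgHom.id_apply, QTorus.lift_x]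
    by_cases ha : a = i
    · subst ha
      rw [Function.update_self, ← MonoidHom.coe_coe, ← Units.coe_map, map_mul, map_zpow,
        QTorus.map_lift_x, QTorus.map_lift_x, Function.update_self, Function.update_of_ne hij.symm]
      simp
    · rw [Function.update_of_ne ha, QTorus.lift_x, Function.update_of_ne ha]

end Transvection

/-! ### Alternating elimination on the exponents -/

section Reduction

variable {K : Type u} [Field K] {n : ℕ}

/-- The parameter matrices obtained from `q` by transvections with indices in `S`. -/
inductive Reach (S : Finset (Fin n)) (q : Matrix (Fin n) (Fin n) Kˣ) :
    Matrix (Fin n) (Fin n) Kˣ → Prop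
  | refl : Reach S q q
  | step {q' : Matrix (Fin n) (Fin n) Kˣ} {i j : Fin n} (t : ℤ) (h : Reach S q q') (hi : i ∈ S)
      (hj : j ∈ S) (hij : i ≠ j) : Reach S q (transvect q' i j t)

namespace Reach

variable {S T : Finset (Fin n)} {q q' q'' : Matrix (Fin n) (Fin n) Kˣ}

theorem isMulAntisymm (h : Reach S q q') (hq : IsMulAntisymm q) : IsMulAntisymm q' := by
  induction h with
  | refl => exact hq
  | step t _ _ _ _ ih => exact ih.transvect t

theorem trans (h : Reach S q q') (h' : Reach S q' q'') : Reach S q q'' := by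
  induction h' with
  | refl => exact h
  | step t _ hi hj hij ih => exact ih.step t hi hj hij

theorem mono (h : Reach S q q') (hST : S ⊆ T) : Reach T q q' := by
  induction h with
  | refl => exact refl
  | step t _ hi hj hij ih => exact ih.step t (hST hi) (hST hj) hij

theorem symm (h : Reach S q q') (hq : IsMulAntisymm q) : Reach S q' q := by
  induction h with
  | refl => exact refl
  | @step q' i j t h hi hj hij ih =>
    have := (refl (q := transvect q' i j t)).step (-t) hi hj hij
    rw [transvect_neg (h.isMulAntisymm hq) hij] at this
    exact this.trans ih

theorem mem_subgroup (h : Reach S q q') {H : Subgroup Kˣ}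
    (hH : ∀ a ∈ S, ∀ b ∈ S, q a b ∈ H) : ∀ a ∈ S, ∀ b ∈ S, q' a b ∈ H := by
  induction h with
  | refl => exact hH
  | step t _ hi hj hij ih =>
    intro a ha b hb
    refine mul_mem (mul_mem (ih a ha b hb) ?_) ?_
    · split_ifs
      exacts [zpow_mem (ih _ hj _ hb) _, one_mem _]
    · split_ifs
      exacts [zpow_mem (ih _ ha _ hj) _, one_mem _]

/-- If `x b` commutes with every `x a` for `a ∈ S`, multiplying by powers of such `x a` cannot
change its parameters. This keeps the cleared rows of a pivot intact while the remaining indices are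
reduced. -/
theorem apply_eq_of_notMem (h : Reach S q q') {b : Fin n} (hb : b ∉ S)
    (hq : ∀ a ∈ S, q a b = 1) (a : Fin n) : q' a b = q a b := by
  induction h generalizing a with
  | refl => rfl
  | @step q' i j t _ hi hj hij ih =>
    have hbi : b ≠ i := fun h => hb (h ▸ hi)
    by_cases ha : a = i
    · rw [ha, transvect_left _ hbi, ih, ih, hq j hj, one_zpow, mul_one]
    · rw [transvect_of_ne _ ha hbi, ih]

theorem nonempty_algEquiv (h : Reach S q q') (hq : IsMulAntisymm q) :
    Nonempty (QTorus q ≃ₐ[K] QTorus q') := by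
  induction h with
  | refl => exact ⟨AlgEquiv.refl⟩
  | step t h _ _ hij ih =>
    exact ⟨ih.some.trans (nonempty_algEquiv_transvect (h.isMulAntisymm hq) hij t).some⟩

end Reach

theorem mem_zpowers_of_pow_dvd {G : Type*} [Group G] {g : G} {d : ℕ} {c : ℤ} (h : (d : ℤ) ∣ c) :
    g ^ c ∈ Subgroup.zpowers (g ^ d) := by
  obtain ⟨k, rfl⟩ := h
  exact ⟨k, by simp [zpow_mul]⟩

/-- Exponents of `g` are defined only modulo `orderOf g`, so divisibility of an exponent by `d` is
meaningful precisely because `d` divides the order. -/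
theorem dvd_of_pow_mem_zpowers {G : Type*} [Group G] {g : G} {d c : ℕ} (hd : d ∣ orderOf g)
    (h : g ^ c ∈ Subgroup.zpowers (g ^ d)) : d ∣ c := by
  obtain ⟨k, hk⟩ := h
  have h1 : g ^ ((d : ℤ) * k - c) = 1 := by
    rw [zpow_sub, zpow_mul, zpow_natCast, zpow_natCast]
    simp only at hk
    rw [hk, mul_inv_cancel]
  have h2 := (Int.natCast_dvd_natCast.mpr hd).trans (orderOf_dvd_iff_zpow_eq_one.mpr h1)
  have h3 := (dvd_sub_right (dvd_mul_right (d : ℤ) k)).mp h2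
  exact_mod_cast h3

theorem exists_pow_eq_of_ne_one {G : Type*} [Group G] {g a : G} (hg : 0 < orderOf g)
    (ha : a ∈ Subgroup.zpowers g) (h1 : a ≠ 1) : ∃ c : ℕ, 0 < c ∧ c < orderOf g ∧ a = g ^ c := by
  obtain ⟨k, rfl⟩ := ha
  have hg' : (orderOf g : ℤ) ≠ 0 := by positivity
  have h0 := Int.emod_nonneg k hg'
  have h2 := Int.emod_lt_of_pos k (by positivity : (0 : ℤ) < orderOf g)
  have h3 : g ^ (k % (orderOf g : ℤ)) = g ^ k := zpow_mod_orderOf g k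
  obtain ⟨c, hc⟩ := Int.eq_ofNat_of_zero_le h0
  rw [hc] at h2 h3
  refine ⟨c, Nat.pos_of_ne_zero ?_, by exact_mod_cast h2, by simpa using h3.symm⟩
  rintro rfl
  exact h1 (by simpa using h3.symm)

variable {g : Kˣ}

/-- A pivot with minimal exponent divides all entries after clearing its two rows. -/
theorem exists_pivot (hg : 0 < orderOf g) {S : Finset (Fin n)} (hS : 3 ≤ S.card)
    {q : Matrix (Fin n) (Fin n) Kˣ} (hq : IsMulAntisymm q)
    (hqg : ∀ a ∈ S, ∀ b ∈ S, q a b ∈ Subgroup.zpowers g)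
    (hne : ∃ a ∈ S, ∃ b ∈ S, q a b ≠ 1) :
    ∃ q', Reach S q q' ∧ ∃ i ∈ S, ∃ j ∈ S, ∃ d : ℕ, i ≠ j ∧ 0 < d ∧ d < orderOf g ∧
      d ∣ orderOf g ∧ q' i j = g ^ d ∧
      (∀ k ∈ S, k ≠ i → k ≠ j → q' i k = 1 ∧ q' j k = 1) ∧
      ∀ a ∈ S, ∀ b ∈ S, q' a b ∈ Subgroup.zpowers (g ^ d) := by
  classical
  -- The minimum runs over all matrices in reach and all pairs of indices, so that any remainder
  -- produced later by a further operation is already covered by minimality.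
  let P : ℕ → Prop := fun d => 0 < d ∧ ∃ q', Reach S q q' ∧ ∃ i ∈ S, ∃ j ∈ S, i ≠ j ∧
    q' i j = g ^ d
  obtain ⟨a, ha, b, hb, hab⟩ := hne
  obtain ⟨c, hc0, hcm, hc⟩ := exists_pow_eq_of_ne_one hg (hqg a ha b hb) hab
  have hP : ∃ d, P d := ⟨c, hc0, q, .refl, a, ha, b, hb, fun h => hab (h ▸ hq.1 a), hc⟩
  obtain ⟨hd0, q', hq', i, hi, j, hj, hij, hd⟩ := Nat.find_spec hP
  have hmin : ∀ d, P d → Nat.find hP ≤ d := fun d hd => Nat.find_min' hP hd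
  have hdm : Nat.find hP < orderOf g :=
    (hmin c ⟨hc0, q, .refl, a, ha, b, hb, fun h => hab (h ▸ hq.1 a), hc⟩).trans_lt hcm
  generalize Nat.find hP = d at *
  have hdZ : (0 : ℤ) < d := by exact_mod_cast hd0
  have key : ∀ q'', Reach S q q'' → ∀ k ∈ S, ∀ l ∈ S, k ≠ l → ∀ c : ℤ, q'' k l = g ^ c →
      0 ≤ c → c < d → c = 0 := by
    intro q'' h k hk l hl hkl c hc hc0 hcd
    by_contra hne
    obtain ⟨c, rfl⟩ := Int.eq_ofNat_of_zero_le hc0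
    have := hmin c ⟨by omega, q'', h, k, hk, l, hl, hkl, by simpa using hc⟩
    omega
  -- Multiplying `x k` by `x j ^ (-(c / d))` replaces the exponent `c` at `(i, k)` by `c % d`, which
  -- minimality forces to be zero. The next claim does the same for row `j`, with `x i` as the
  -- multiplier.
  have row : ∀ q'', Reach S q q'' → q'' i j = g ^ d → ∀ k ∈ S, k ≠ i → k ≠ j → ∀ c : ℤ,
      q'' i k = g ^ c → (d : ℤ) ∣ c := by
    intro q'' h hd k hk hki hkj c hc
    refine Int.dvd_of_emod_eq_zero ?_
    refine key _ (h.step (-(c / d)) hk hj hkj) i hi k hk hki.symm _ ?_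
      (Int.emod_nonneg _ hdZ.ne') (Int.emod_lt_of_pos _ hdZ)
    rw [transvect_right _ hki.symm, hc, hd, ← zpow_natCast g d, ← zpow_mul, ← zpow_add,
      Int.emod_def]
    congr 1; ring
  have row' : ∀ q'', Reach S q q'' → q'' i j = g ^ d → ∀ k ∈ S, k ≠ i → k ≠ j → ∀ c : ℤ,
      q'' j k = g ^ c → (d : ℤ) ∣ c := by
    intro q'' h hd k hk hki hkj c hc
    refine Int.dvd_of_emod_eq_zero ?_
    refine key _ (h.step (c / d) hk hi hki) j hj k hk hkj.symm _ ?_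
      (Int.emod_nonneg _ hdZ.ne') (Int.emod_lt_of_pos _ hdZ)
    rw [transvect_right _ hkj.symm, hc, (h.isMulAntisymm hq).2 i j, hd, ← zpow_natCast g d,
      ← zpow_neg, ← zpow_mul, ← zpow_add, Int.emod_def]
    congr 1; ring
  have hmem : ∀ q'', Reach S q q'' → ∀ k ∈ S, ∀ l ∈ S, ∃ c : ℤ, q'' k l = g ^ c := by
    intro q'' h k hk l hl
    obtain ⟨c, hc⟩ := h.mem_subgroup hqg k hk l hl
    exact ⟨c, hc.symm⟩
  -- A third index `k` is essential here: its entry in row `i` is represented by both `c` and `c +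
  -- orderOf g`, and `d` divides each of them.
  have hdvd : d ∣ orderOf g := by
    obtain ⟨k, hk, hki, hkj⟩ : ∃ k ∈ S, k ≠ i ∧ k ≠ j := by
      obtain ⟨k, hk⟩ : ((S.erase i).erase j).Nonempty := by
        rw [← Finset.card_pos]
        have h1 := Finset.pred_card_le_card_erase (s := S) (a := i)
        have h2 := Finset.pred_card_le_card_erase (s := S.erase i) (a := j)
        omega
      simp only [Finset.mem_erase] at hk
      exact ⟨k, hk.2.2, hk.2.1, hk.1⟩
    obtain ⟨c, hc⟩ := hmem q' hq' i hi k hk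
    have h1 := row q' hq' hd k hk hki hkj c hc
    have h2 := row q' hq' hd k hk hki hkj (c + orderOf g) (by
      rw [hc, zpow_add, zpow_natCast, pow_orderOf_eq_one, mul_one])
    have h3 := (dvd_add_right h1).mp h2
    exact_mod_cast h3
  have clean : ∀ F ⊆ (S.erase i).erase j, ∃ q'', Reach S q q'' ∧ q'' i j = g ^ d ∧
      ∀ k ∈ F, q'' i k = 1 ∧ q'' j k = 1 := by
    intro F
    induction F using Finset.induction_on with
    | empty => exact fun _ => ⟨q', hq', hd, by simp⟩
    | insert k F hk ih =>
      intro hF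
      obtain ⟨q'', h, hd, hF'⟩ := ih ((Finset.subset_insert _ _).trans hF)
      have hkS := hF (Finset.mem_insert_self _ _)
      simp only [Finset.mem_erase] at hkS
      obtain ⟨hkj, hki, hkS⟩ := hkS
      obtain ⟨c, hc⟩ := hmem q'' h i hi k hkS
      obtain ⟨c', hc'⟩ := hmem q'' h j hj k hkS
      obtain ⟨e, rfl⟩ := row q'' h hd k hkS hki hkj c hc
      obtain ⟨e', rfl⟩ := row' q'' h hd k hkS hki hkj c' hc'
      have hanti := h.isMulAntisymm hq
      -- Both operations alter only row and column `k`: the first clears the entry at `(i, k)`, the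
      -- second the entry at `(j, k)`, and the indices already in `F` are unaffected.
      refine ⟨_, (h.step (-e) hkS hj hkj).step e' hkS hi hki, ?_, ?_⟩
      · rw [transvect_of_ne _ hki.symm hkj.symm, transvect_of_ne _ hki.symm hkj.symm, hd]
      · intro l hl
        rcases Finset.mem_insert.mp hl with rfl | hl
        · rw [transvect_right _ hki.symm, transvect_right _ hki.symm, transvect_right _ hkj.symm,
            transvect_right _ hkj.symm, transvect_of_ne _ hki.symm hki.symm,
            transvect_of_ne _ hkj.symm hki.symm, hanti.1, hanti.1, hc, hc', hanti.2 i j, hd]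
          constructor <;> simp [zpow_mul]
        · have hlk : l ≠ k := fun h => hk (h ▸ hl)
          rw [transvect_of_ne _ hki.symm hlk, transvect_of_ne _ hki.symm hlk,
            transvect_of_ne _ hkj.symm hlk, transvect_of_ne _ hkj.symm hlk]
          exact hF' l hl
  obtain ⟨q'', h, hd, hc⟩ := clean _ subset_rfl
  have hc : ∀ k ∈ S, k ≠ i → k ≠ j → q'' i k = 1 ∧ q'' j k = 1 := fun k hk hki hkj =>
    hc k (by simp [hk, hki, hkj])
  have hanti := h.isMulAntisymm hq
  refine ⟨q'', h, i, hi, j, hj, d, hij, hd0, hdm, hdvd, hd, hc, ?_⟩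
  have hij_mem : ∀ b ∈ S, q'' i b ∈ Subgroup.zpowers (g ^ d) ∧
      q'' j b ∈ Subgroup.zpowers (g ^ d) := by
    intro b hb
    by_cases hbi : b = i
    · rw [hbi, hanti.1, hanti.2 i j, hd]
      exact ⟨one_mem _, inv_mem (Subgroup.mem_zpowers _)⟩
    by_cases hbj : b = j
    · rw [hbj, hanti.1, hd]
      exact ⟨Subgroup.mem_zpowers _, one_mem _⟩
    rw [(hc b hb hbi hbj).1, (hc b hb hbi hbj).2]
    exact ⟨one_mem _, one_mem _⟩
  intro a ha b hb
  by_cases hai : a = i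
  · exact hai ▸ (hij_mem b hb).1
  by_cases haj : a = j
  · exact haj ▸ (hij_mem b hb).2
  by_cases hbi : b = i
  · rw [hbi, hanti.2 i a]
    exact inv_mem (hij_mem a ha).1
  by_cases hbj : b = j
  · rw [hbj, hanti.2 j a]
    exact inv_mem (hij_mem a ha).2
  obtain ⟨c, hcab⟩ := hmem q'' h a ha b hb
  rw [hcab]
  -- Multiplying `x i` by `x a` keeps the pivot, as the entry at `(a, j)` is trivial, and moves the
  -- entry at `(a, b)` into row `i`, where divisibility is known.
  refine mem_zpowers_of_pow_dvd (row _ (h.step 1 hi ha (Ne.symm hai)) ?_ b hb hbi hbj c ?_)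
  · rw [transvect_left _ hij.symm, hanti.2 j a, (hc a ha hai haj).2, hd]
    simp
  · rw [transvect_left _ hbi, (hc b hb hbi hbj).1, hcab]
    simp

end Reduction

/-! ### Recursion to the block form -/

section NormalForm

variable {K : Type u} [Field K] {n : ℕ}

/-- On the index set `S` the matrix `q` is a direct sum of rank two blocks at the pairs
`(e (i, 0), e (i, 1))` with parameters `g ^ normalExp S.card h z i`, and of a trivial part. -/
structure IsBlockForm (q : Matrix (Fin n) (Fin n) Kˣ) (g : Kˣ) (S : Finset (Fin n)) {s : ℕ}
    (h : Fin s → ℕ) (z : ℕ) (e : Fin s × Fin 2 → Fin n) : Prop where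
  injective : Function.Injective e
  mem : ∀ p, e p ∈ S
  dvd : ∀ i, h i ∣ orderOf g
  lt : ∀ i, h i < orderOf g
  chain : ∀ i j, i ≤ j → h i ∣ h j
  order_eq : ∀ i, orderOf (g ^ normalExp S.card h z i) = orderOf (g ^ h i)
  apply_eq : ∀ i, q (e (i, 0)) (e (i, 1)) = g ^ normalExp S.card h z i
  eq_one : ∀ a ∈ S, ∀ b ∈ S, q a b ≠ 1 →
    ∃ i, (a = e (i, 0) ∧ b = e (i, 1)) ∨ (a = e (i, 1) ∧ b = e (i, 0))

theorem exists_isBlockForm_of_trivial {q : Matrix (Fin n) (Fin n) Kˣ} (g : Kˣ)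
    {S : Finset (Fin n)} (hS : ∀ a ∈ S, ∀ b ∈ S, q a b = 1) (h : Fin 0 → ℕ) (z : ℕ) :
    ∃ e, IsBlockForm q g S h z e :=
  ⟨fun p => p.1.elim0, ⟨fun p => p.1.elim0, fun p => p.1.elim0, fun i => i.elim0,
    fun i => i.elim0, fun i => i.elim0, fun i => i.elim0, fun i => i.elim0,
    fun a ha b hb hab => absurd (hS a ha b hb) hab⟩⟩

/-- The entry `g ^ c` is split as `c = z * d` with `d = c.gcd (orderOf g)`. Then `g ^ c` and `g ^ d`
have the same order, hence generate the same subgroup, and `d` is the largest divisor of the order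
compatible with the entry. -/
theorem exists_isBlockForm_of_pair {q : Matrix (Fin n) (Fin n) Kˣ} (hq : IsMulAntisymm q)
    {g : Kˣ} (hg : 0 < orderOf g) {i j : Fin n} (hij : i ≠ j)
    (hqg : q i j ∈ Subgroup.zpowers g) (hne : q i j ≠ 1) :
    ∃ d z : ℕ, q i j ∈ Subgroup.zpowers (g ^ d) ∧
      (∀ d₀, d₀ ∣ orderOf g → q i j ∈ Subgroup.zpowers (g ^ d₀) → d₀ ∣ d) ∧
      ∃ e, IsBlockForm q g {i, j} (fun _ : Fin 1 => d) z e := by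
  obtain ⟨c, hc0, hcm, hc⟩ := exists_pow_eq_of_ne_one hg hqg hne
  have hcard : ({i, j} : Finset (Fin n)).card = 2 := Finset.card_pair hij
  have hz : c / c.gcd (orderOf g) * c.gcd (orderOf g) = c :=
    Nat.div_mul_cancel (Nat.gcd_dvd_left _ _)
  refine ⟨c.gcd (orderOf g), c / c.gcd (orderOf g), ?_, ?_, fun p => if p.2 = 0 then i else j, ?_⟩
  · rw [hc, ← zpow_natCast]
    exact mem_zpowers_of_pow_dvd (Int.natCast_dvd_natCast.mpr (Nat.gcd_dvd_left _ _))
  · intro d₀ hd₀ h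
    rw [hc] at h
    exact Nat.dvd_gcd (dvd_of_pow_mem_zpowers hd₀ h) hd₀
  have hexp : ∀ k : Fin 1, normalExp ({i, j} : Finset (Fin n)).card
      (fun _ : Fin 1 => c.gcd (orderOf g)) (c / c.gcd (orderOf g)) k = c := by
    intro k
    rw [normalExp, if_pos ⟨by rw [hcard], by omega⟩, hz]
  refine ⟨?_, ?_, fun _ => Nat.gcd_dvd_right _ _,
    fun _ => (Nat.gcd_le_left _ hc0).trans_lt hcm, fun _ _ _ => dvd_rfl, ?_, ?_, ?_⟩
  · rintro ⟨a, b⟩ ⟨a', b'⟩ h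
    have : a = a' := Subsingleton.elim _ _
    subst this
    fin_cases b <;> fin_cases b' <;> simp_all
  · intro p
    split_ifs <;> simp
  · intro k
    have hfin : IsOfFinOrder g := orderOf_pos_iff.mp hg
    rw [hexp, hfin.orderOf_pow, hfin.orderOf_pow, Nat.gcd_comm c,
      Nat.gcd_eq_right (Nat.gcd_dvd_left _ _)]
  · intro k
    rw [hexp]
    simpa using hc
  · intro a ha b hb hab
    refine ⟨0, ?_⟩
    simp only [Finset.mem_insert, Finset.mem_singleton] at ha hb
    rcases ha with rfl | rfl <;> rcases hb with rfl | rfl <;> simp_all [hq.1]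

theorem normalExp_cons_succ (N : ℕ) {s : ℕ} (d : ℕ) (h : Fin s → ℕ) (z : ℕ) (i : Fin s) :
    normalExp (N + 2) (Fin.cons d h : Fin (s + 1) → ℕ) z i.succ = normalExp N h z i := by
  simp only [normalExp, Fin.cons_succ, Fin.val_succ]
  congr 1
  simp only [eq_iff_iff]
  constructor <;> rintro ⟨h1, h2⟩ <;> constructor <;> omega

theorem normalExp_zero_of_three_le {N : ℕ} (hN : 3 ≤ N) {s : ℕ} (h : Fin (s + 1) → ℕ) (z : ℕ) :
    normalExp N h z 0 = h 0 := by
  rw [normalExp, if_neg]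
  simp only [Fin.val_zero]
  omega

/-- With at least three indices the new first block is never both last and exhaustive, so its
exponent is `d` itself. Removing one block lowers the index count by two, hence the multiplier `z`
stays where it was. -/
theorem IsBlockForm.cons {q : Matrix (Fin n) (Fin n) Kˣ} (hq : IsMulAntisymm q) {g : Kˣ}
    {S : Finset (Fin n)} (hS : 3 ≤ S.card) {i j : Fin n} (hi : i ∈ S) (hj : j ∈ S) (hij : i ≠ j)
    {d : ℕ} (hd : d ∣ orderOf g) (hdm : d < orderOf g) (hqij : q i j = g ^ d)
    (hone : ∀ k ∈ S, k ≠ i → k ≠ j → q i k = 1 ∧ q j k = 1) {s : ℕ} {h : Fin s → ℕ} {z : ℕ}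
    {e : Fin s × Fin 2 → Fin n} (H : IsBlockForm q g ((S.erase i).erase j) h z e)
    (hdh : ∀ k, d ∣ h k) :
    ∃ e', IsBlockForm q g S (Fin.cons d h : Fin (s + 1) → ℕ) z e' := by
  classical
  have hcard : S.card = ((S.erase i).erase j).card + 2 := by
    rw [Finset.card_erase_of_mem (by simp [hj, hij.symm]), Finset.card_erase_of_mem hi]
    omega
  have hmem : ∀ p, e p ≠ i ∧ e p ≠ j ∧ e p ∈ S := by
    intro p
    have := H.mem p
    simp only [Finset.mem_erase] at this
    exact ⟨this.2.1, this.1, this.2.2⟩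
  let e' : Fin (s + 1) × Fin 2 → Fin n := fun p =>
    Fin.cases (motive := fun _ => Fin n) (if p.2 = 0 then i else j) (fun k => e (k, p.2)) p.1
  have he0 : e' (0, 0) = i := rfl
  have he1 : e' (0, 1) = j := rfl
  have hes : ∀ k a, e' (Fin.succ k, a) = e (k, a) := fun k a => rfl
  have he01 : ∀ a, e' (0, a) = i ∨ e' (0, a) = j := by
    intro a; fin_cases a <;> simp [he0, he1]
  refine ⟨e', ⟨?_, ?_, ?_, ?_, ?_, ?_, ?_, ?_⟩⟩
  · rintro ⟨k, a⟩ ⟨l, b⟩ hkl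
    refine Fin.cases ?_ (fun k => ?_) k hkl <;> refine Fin.cases ?_ (fun l => ?_) l
    · intro hkl
      fin_cases a <;> fin_cases b <;> simp_all
    · intro hkl
      rw [hes] at hkl
      rcases he01 a with h | h <;> rw [h] at hkl
      exacts [absurd hkl.symm (hmem _).1, absurd hkl.symm (hmem _).2.1]
    · intro hkl
      rw [hes] at hkl
      rcases he01 b with h | h <;> rw [h] at hkl
      exacts [absurd hkl (hmem _).1, absurd hkl (hmem _).2.1]
    · intro hkl
      rw [hes, hes] at hkl
      have := H.injective hkl
      simp_all
  · rintro ⟨k, a⟩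
    refine Fin.cases ?_ (fun k => ?_) k
    · rcases he01 a with h | h <;> rw [h] <;> assumption
    · exact (hmem _).2.2
  · exact Fin.cases hd H.dvd
  · exact Fin.cases hdm H.lt
  · intro k l
    refine Fin.cases ?_ (fun k => ?_) k <;> refine Fin.cases ?_ (fun l => ?_) l
    · simp
    · intro _
      exact hdh l
    · intro h
      simp at h
    · intro h
      exact H.chain k l (Fin.succ_le_succ_iff.mp h)
  · refine Fin.cases ?_ fun k => ?_
    · rw [normalExp_zero_of_three_le hS]
    · rw [hcard, normalExp_cons_succ]
      exact H.order_eq k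
  · refine Fin.cases ?_ fun k => ?_
    · rw [normalExp_zero_of_three_le hS]
      exact hqij
    · rw [hcard, normalExp_cons_succ]
      exact H.apply_eq k
  · intro a ha b hb hab
    by_cases hai : a = i
    · subst hai
      have hbj : b = j := by
        by_contra hbj
        refine hab ?_
        by_cases hba : b = a
        · rw [hba, hq.1]
        · exact (hone b hb hba hbj).1
      exact ⟨0, Or.inl ⟨rfl, hbj⟩⟩
    by_cases haj : a = j
    · subst haj
      have hbi : b = i := by
        by_contra hbi
        refine hab ?_
        by_cases hba : b = a
        · rw [hba, hq.1]
        · exact (hone b hb hbi hba).2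
      exact ⟨0, Or.inr ⟨rfl, hbi⟩⟩
    have hbi : b ≠ i := by
      rintro rfl
      exact hab (by rw [hq.2 b a, (hone a ha hai haj).1, inv_one])
    have hbj : b ≠ j := by
      rintro rfl
      exact hab (by rw [hq.2 b a, (hone a ha hai haj).2, inv_one])
    obtain ⟨k, hk⟩ := H.eq_one a (by simp [*]) b (by simp [*]) hab
    exact ⟨k.succ, hk⟩

/-- The divisor `d₀` hands the previous pivot down the recursion and produces the chain. The last
clause records that the first pivot divides every original exponent; for a generating set of
parameters it forces the first divisor to be one. -/
theorem exists_reach_isBlockForm {g : Kˣ} (hg : 0 < orderOf g) (N : ℕ) :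
    ∀ (S : Finset (Fin n)), S.card = N → ∀ (q : Matrix (Fin n) (Fin n) Kˣ), IsMulAntisymm q →
    ∀ d₀, d₀ ∣ orderOf g → (∀ a ∈ S, ∀ b ∈ S, q a b ∈ Subgroup.zpowers (g ^ d₀)) →
    ∃ (q' : Matrix (Fin n) (Fin n) Kˣ) (s : ℕ) (h : Fin s → ℕ) (z : ℕ)
      (e : Fin s × Fin 2 → Fin n), Reach S q q' ∧ IsBlockForm q' g S h z e ∧ (∀ i, d₀ ∣ h i) ∧
      ∀ i : Fin s, i.val = 0 → ∀ a ∈ S, ∀ b ∈ S, q a b ∈ Subgroup.zpowers (g ^ h i) := by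
  classical
  induction N using Nat.strong_induction_on with
  | _ N ih =>
  intro S hSN q hq d₀ hd₀ hqd
  by_cases htriv : ∀ a ∈ S, ∀ b ∈ S, q a b = 1
  · obtain ⟨e, he⟩ := exists_isBlockForm_of_trivial g htriv Fin.elim0 0
    exact ⟨q, 0, _, _, e, .refl, he, fun i => i.elim0, fun i => i.elim0⟩
  push Not at htriv
  have hqg : ∀ a ∈ S, ∀ b ∈ S, q a b ∈ Subgroup.zpowers g := fun a ha b hb =>
    (Subgroup.zpowers_le.mpr (pow_mem (Subgroup.mem_zpowers g) d₀)) (hqd a ha b hb)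
  by_cases hS : 3 ≤ S.card
  · obtain ⟨q', hr, i, hi, j, hj, d, hij, hd, hdm, hdvd, hqij, hone, hall⟩ :=
      exists_pivot hg hS hq hqg htriv
    have hq' := hr.isMulAntisymm hq
    have hsub : (S.erase i).erase j ⊆ S := (Finset.erase_subset _ _).trans (Finset.erase_subset _ _)
    obtain ⟨q'', s, h, z, e, hr', he, hdh, -⟩ := ih _ (by
      rw [← hSN]
      exact (Finset.card_erase_le).trans_lt (Finset.card_erase_lt_of_mem hi))
      ((S.erase i).erase j) rfl q' hq' d hdvd
      (fun a ha b hb => hall a (hsub ha) b (hsub hb))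
    have hdd : d₀ ∣ d := dvd_of_pow_mem_zpowers hd₀ (hqij ▸ hr.mem_subgroup hqd i hi j hj)
    have hq'' := hr'.isMulAntisymm hq'
    -- The recursive operations use only indices off the pivot, whose entries against `i` and `j`
    -- are trivial.
    have hcol : ∀ b, b = i ∨ b = j → ∀ a, q'' a b = q' a b := by
      intro b hb a
      refine hr'.apply_eq_of_notMem (by rcases hb with rfl | rfl <;> simp) (fun a ha => ?_) a
      simp only [Finset.mem_erase] at ha
      have := hone a ha.2.2 ha.2.1 ha.1
      rcases hb with rfl | rfl
      · rw [hq'.2 b a, this.1, inv_one]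
      · rw [hq'.2 b a, this.2, inv_one]
    obtain ⟨e', he'⟩ := he.cons hq'' hS hi hj hij hdvd hdm (by rw [hcol j (Or.inr rfl), hqij])
      (fun k hk hki hkj => by
        rw [hq''.2 k i, hq''.2 k j, hcol i (Or.inl rfl), hcol j (Or.inr rfl), hq'.2 i k, hq'.2 j k,
          (hone k hk hki hkj).1, (hone k hk hki hkj).2]
        simp) hdh
    refine ⟨q'', s + 1, _, z, e', hr.trans (hr'.mono hsub), he', ?_, ?_⟩
    · exact Fin.cases hdd fun k => hdd.trans (hdh k)
    · intro k hk a ha b hb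
      obtain rfl : k = 0 := Fin.ext hk
      exact (hr.symm hq).mem_subgroup hall a ha b hb
  · obtain ⟨i, hi, j, hj, hne⟩ := htriv
    have hij : i ≠ j := by
      rintro rfl
      exact hne (hq.1 i)
    have hSij : S = {i, j} := by
      refine (Finset.eq_of_subset_of_card_le ?_ ?_).symm
      · simp [Finset.insert_subset_iff, hi, hj]
      · rw [Finset.card_pair hij]
        omega
    obtain ⟨d, z, hd, hmax, e, he⟩ := exists_isBlockForm_of_pair hq hg hij (hqg i hi j hj) hne
    refine ⟨q, 1, _, z, e, .refl, hSij ▸ he, fun _ => hmax d₀ hd₀ (hqd i hi j hj), ?_⟩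
    intro _ _ a ha b hb
    rw [hSij] at ha hb
    simp only [Finset.mem_insert, Finset.mem_singleton] at ha hb
    rcases ha with rfl | rfl <;> rcases hb with rfl | rfl
    · rw [hq.1]; exact one_mem _
    · exact hd
    · rw [hq.2 b a]; exact inv_mem hd
    · rw [hq.1]; exact one_mem _

end NormalForm

/-- A centralizer is a subalgebra closed under inverses of units, so commutation need only be tested
on the `x i`. -/
theorem QTorus.commute_map {K : Type u} [Field K] {n : ℕ} {q : Matrix (Fin n) (Fin n) Kˣ}
    {B : Type*} [Semiring B] [Algebra K B] (f : QTorus q →ₐ[K] B) {b : B}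
    (h : ∀ i, Commute (f (QTorus.x q i)) b) (a : QTorus q) : Commute (f a) b := by
  have : (Subalgebra.centralizer K {b}).comap f = ⊤ := by
    rw [eq_top_iff, ← QTorus.adjoin_x_eq_top, Algebra.adjoin_le_iff]
    rintro _ (⟨i, rfl⟩ | ⟨i, rfl⟩)
    · rw [SetLike.mem_coe, Subalgebra.mem_comap, Subalgebra.mem_centralizer_iff]
      rintro _ rfl
      exact (h i).symm.eq
    · have : Commute (↑(Units.map (f : QTorus q →* B) (QTorus.x q i))⁻¹) b :=
        Commute.units_inv_left (h i)
      rw [SetLike.mem_coe, Subalgebra.mem_comap, Subalgebra.mem_centralizer_iff]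
      rintro _ rfl
      simpa using this.symm.eq
  have ha : a ∈ (Subalgebra.centralizer K {b}).comap f := this ▸ Algebra.mem_top
  exact ((Subalgebra.mem_centralizer_iff K).mp ha b rfl).symm

/-- This is what makes the ordered product map on a tensor product of algebras multiplicative when
the factors have commuting images. -/
theorem list_ofFn_prod_mul {B : Type*} [Monoid B] : ∀ {s : ℕ} (f g : Fin s → B),
    (∀ i j, i ≠ j → Commute (f i) (g j)) →
    (List.ofFn fun i => f i * g i).prod = (List.ofFn f).prod * (List.ofFn g).prod
  | 0, _, _, _ => by simp
  | s + 1, f, g, h => by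
    simp only [List.ofFn_succ, List.prod_cons]
    rw [list_ofFn_prod_mul (fun i => f i.succ) (fun i => g i.succ)
      fun i j hij => h _ _ fun h => hij (Fin.succ_injective _ h)]
    have : Commute (List.ofFn fun i : Fin s => f i.succ).prod (g 0) := by
      refine Commute.list_prod_left _ _ fun b hb => ?_
      obtain ⟨i, rfl⟩ := List.mem_ofFn' _ _ |>.mp hb
      exact h _ _ (Fin.succ_ne_zero i)
    rw [mul_assoc, mul_assoc, ← mul_assoc (g 0), ← this.eq, mul_assoc]

theorem list_ofFn_prod_eq {B : Type*} [Monoid B] : ∀ {s : ℕ} (f : Fin s → B) (i : Fin s),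
    (∀ j, j ≠ i → f j = 1) → (List.ofFn f).prod = f i
  | s + 1, f, i, h => by
    rw [List.ofFn_succ, List.prod_cons]
    refine Fin.cases (fun h => ?_) (fun i h => ?_) i h
    · rw [List.prod_eq_one, mul_one]
      intro b hb
      obtain ⟨j, rfl⟩ := List.mem_ofFn' _ _ |>.mp hb
      exact h _ (Fin.succ_ne_zero j)
    · rw [h 0 (Fin.succ_ne_zero i).symm, one_mul]
      exact list_ofFn_prod_eq (fun j => f j.succ) i
        fun j hj => h _ fun h => hj (Fin.succ_injective _ h)

/-! ### Block tori as tensor products -/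

section Block

variable {K : Type u} [Field K] {s : ℕ} (ε : Fin s → Kˣ) (r : ℕ)

/-- The parameters of the direct sum of the rank two blocks with parameters `ε i` and of a
trivial part of rank `r`. -/
def blockParam : (Fin s × Fin 2) ⊕ Fin r → (Fin s × Fin 2) ⊕ Fin r → Kˣ
  | Sum.inl (i, a), Sum.inl (j, b) =>
    if i = j then (!![1, ε i; (ε i)⁻¹, 1] : Matrix (Fin 2) (Fin 2) Kˣ) a b else 1
  | _, _ => 1

/-- The tensor product of quantum tori of rank two and a group algebra. -/
abbrev BlockTorus : Type u :=
  (⨂[K] i : Fin s, QTorus₂ (ε i)) ⊗[K] AddMonoidAlgebra K (Fin r → ℤ)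

namespace BlockTorus

/-- The inclusion of a rank two factor. -/
noncomputable def inc (i : Fin s) : QTorus₂ (ε i) →ₐ[K] BlockTorus ε r :=
  Algebra.TensorProduct.includeLeft.comp
    (PiTensorProduct.singleAlgHom (R := K) (A := fun i => QTorus₂ (ε i)) i)

/-- The monomials of the commutative factor. -/
noncomputable def monomial : (Fin r → Multiplicative ℤ) →* BlockTorus ε r :=
  (((Algebra.TensorProduct.includeRight :
        AddMonoidAlgebra K (Fin r → ℤ) →ₐ[K] BlockTorus ε r) :
        AddMonoidAlgebra K (Fin r → ℤ) →* BlockTorus ε r).comp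
      (AddMonoidAlgebra.of K (Fin r → ℤ))).comp
    (MulEquiv.funMultiplicative (Fin r) ℤ).symm.toMonoidHom

theorem commute_inc_monomial (i : Fin s) (a : QTorus₂ (ε i)) (m : Fin r → Multiplicative ℤ) :
    Commute (inc ε r i a) (monomial ε r m) := by
  simp [inc, monomial, Commute, SemiconjBy]

theorem commute_inc_inc {i j : Fin s} (hij : i ≠ j) (a : QTorus₂ (ε i)) (b : QTorus₂ (ε j)) :
    Commute (inc ε r i a) (inc ε r j b) :=
  (Commute.tprod (Pi.mulSingle_commute (f := fun i => QTorus₂ (ε i)) hij a b)).map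
    (Algebra.TensorProduct.includeLeft :
      (⨂[K] i : Fin s, QTorus₂ (ε i)) →ₐ[K] BlockTorus ε r)

/-- The generators of the tensor product. -/
noncomputable def x : (Fin s × Fin 2) ⊕ Fin r → (BlockTorus ε r)ˣ
  | Sum.inl (i, a) => Units.map (inc ε r i : QTorus₂ (ε i) →* BlockTorus ε r) (QTorus.x _ a)
  | Sum.inr j => Units.map (monomial ε r) (toUnits (Pi.mulSingle j (Multiplicative.ofAdd 1)))

theorem skewCommute_x (p p' : (Fin s × Fin 2) ⊕ Fin r) :
    SkewCommute (blockParam ε r p p') (x ε r p) (x ε r p') := by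
  rcases p with ⟨i, a⟩ | i <;> rcases p' with ⟨j, b⟩ | j
  · by_cases hij : i = j
    · subst hij
      simp only [blockParam, if_true, x]
      exact (QTorus.skewCommute_x _ a b).map _
    · simp only [blockParam, hij, if_false, x]
      rw [skewCommute_one_iff]
      exact Units.ext (commute_inc_inc ε r hij _ _).eq
  · simp only [blockParam, x]
    rw [skewCommute_one_iff]
    exact Units.ext (commute_inc_monomial ε r i _ _).eq
  · simp only [blockParam, x]
    rw [skewCommute_one_iff]
    exact Units.ext (commute_inc_monomial ε r j _ _).eq.symm
  · simp only [blockParam, x]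
    rw [skewCommute_one_iff]
    exact (Commute.all _ _).map _

variable {ε r} {B : Type*} [Semiring B] [Algebra K B]

theorem algHom_ext {f g : BlockTorus ε r →ₐ[K] B} (h : ∀ p, f (x ε r p) = g (x ε r p)) :
    f = g := by
  refine Algebra.TensorProduct.ext ?_ ?_
  · refine PiTensorProduct.algHom_ext fun i => ?_
    exact QTorus.algHom_ext (f := f.comp (inc ε r i)) (g := g.comp (inc ε r i))
      fun a => h (Sum.inl (i, a))
  · refine (AddMonoidAlgebra.lift K B (Fin r → ℤ)).symm.injective ?_
    have : (f : _ →* B).comp (monomial ε r) = (g : _ →* B).comp (monomial ε r) := by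
      refine MonoidHom.pi_ext fun i => ?_
      refine DFunLike.congr_fun
        (f := ((f : _ →* B).comp (monomial ε r)).comp (MonoidHom.mulSingle (fun _ => Multiplicative ℤ) i))
        (g := ((g : _ →* B).comp (monomial ε r)).comp (MonoidHom.mulSingle (fun _ => Multiplicative ℤ) i)) ?_
      exact MonoidHom.ext_mint (h (Sum.inr i))
    refine MonoidHom.ext fun m => ?_
    exact DFunLike.congr_fun this (MulEquiv.funMultiplicative (Fin r) ℤ m)

section Lift

variable (w : (Fin s × Fin 2) ⊕ Fin r → Bˣ)
  (h : ∀ p p', SkewCommute (blockParam ε r p p') (w p) (w p'))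

theorem commute_of_ne (h : ∀ p p', SkewCommute (blockParam ε r p p') (w p) (w p')) {i j : Fin s} (hij : i ≠ j) (a b : Fin 2) :
    Commute (w (Sum.inl (i, a))) (w (Sum.inl (j, b))) := by
  simpa [blockParam, hij, skewCommute_one_iff] using h (Sum.inl (i, a)) (Sum.inl (j, b))

/-- The map from a rank two factor induced by a family of units. -/
noncomputable def liftPair (i : Fin s) : QTorus₂ (ε i) →ₐ[K] B :=
  QTorus.lift (fun a => w (Sum.inl (i, a))) fun a b => by
    simpa [blockParam] using h (Sum.inl (i, a)) (Sum.inl (i, b))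

theorem commute_liftPair {i j : Fin s} (hij : i ≠ j) (a : QTorus₂ (ε i)) (b : QTorus₂ (ε j)) :
    Commute (liftPair w h i a) (liftPair w h j b) := by
  refine QTorus.commute_map _ (fun k => ?_) a
  refine (QTorus.commute_map _ (fun l => ?_) b).symm
  rw [liftPair, liftPair, QTorus.lift_x, QTorus.lift_x]
  exact Units.ext_iff.mp (commute_of_ne w h hij.symm l k).eq

/-- The map from the tensor product of the rank two factors induced by a family of units. -/
noncomputable def liftLeft : (⨂[K] i : Fin s, QTorus₂ (ε i)) →ₐ[K] B :=
  PiTensorProduct.liftAlgHom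
    ((MultilinearMap.mkPiAlgebraFin K s B).compLinearMap fun i => (liftPair w h i).toLinearMap)
    (by simp)
    (by
      intro a b
      simp only [MultilinearMap.compLinearMap_apply, MultilinearMap.mkPiAlgebraFin_apply,
        Pi.mul_apply, AlgHom.toLinearMap_apply, map_mul]
      exact list_ofFn_prod_mul _ _ fun i j hij => commute_liftPair w h hij _ _)

theorem liftLeft_tprod (a : ∀ i : Fin s, QTorus₂ (ε i)) :
    liftLeft w h (PiTensorProduct.tprod K a) = (List.ofFn fun i => liftPair w h i (a i)).prod := by
  simp [liftLeft]

theorem liftLeft_single (i : Fin s) (a : QTorus₂ (ε i)) :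
    liftLeft w h (PiTensorProduct.singleAlgHom (R := K) (A := fun i => QTorus₂ (ε i)) i a) =
      liftPair w h i a := by
  rw [PiTensorProduct.singleAlgHom_apply, liftLeft_tprod,
    list_ofFn_prod_eq (fun j => liftPair w h j _) i fun j hj => ?_]
  · simp
  · simp [Pi.mulSingle_eq_of_ne hj]

/-- The map from the monomials induced by a family of units. -/
noncomputable def liftMonomial : (Fin r → Multiplicative ℤ) →* B :=
  MonoidHom.noncommPiCoprod
    (fun j => (Units.coeHom B).comp (zpowersHom Bˣ (w (Sum.inr j)))) fun i j _ a b => by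
    have : Commute (w (Sum.inr i)) (w (Sum.inr j)) := by
      simpa [blockParam, skewCommute_one_iff] using h (Sum.inr i) (Sum.inr j)
    exact (this.zpow_zpow _ _).map (Units.coeHom B)

theorem commute_liftPair_liftMonomial (i : Fin s) (a : QTorus₂ (ε i))
    (m : Fin r → Multiplicative ℤ) : Commute (liftPair w h i a) (liftMonomial w h m) := by
  refine QTorus.commute_map _ (fun k => ?_) a
  refine MonoidHom.commute_noncommPiCoprod _ (fun j c => ?_) _
  have : Commute (w (Sum.inl (i, k))) (w (Sum.inr j)) := by
    simpa [blockParam, skewCommute_one_iff] using h (Sum.inl (i, k)) (Sum.inr j)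
  rw [liftPair, QTorus.lift_x]
  exact (this.zpow_right _).map (Units.coeHom B)

theorem commute_liftLeft_liftMonomial (a : ⨂[K] i : Fin s, QTorus₂ (ε i))
    (m : Fin r → Multiplicative ℤ) : Commute (liftLeft w h a) (liftMonomial w h m) := by
  induction a using PiTensorProduct.induction_on with
  | smul_tprod c a =>
    rw [map_smul, liftLeft_tprod]
    refine Commute.smul_left (Commute.list_prod_left _ _ fun b hb => ?_) c
    obtain ⟨i, rfl⟩ := List.mem_ofFn' _ _ |>.mp hb
    exact commute_liftPair_liftMonomial w h i _ m
  | add a b ha hb =>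
    rw [map_add]
    exact ha.add_left hb

/-- The universal property of the tensor product of quantum tori of rank two and a group
algebra. -/
noncomputable def lift : BlockTorus ε r →ₐ[K] B :=
  Algebra.TensorProduct.lift (liftLeft w h)
    (AddMonoidAlgebra.lift K B (Fin r → ℤ)
      ((liftMonomial w h).comp (MulEquiv.funMultiplicative (Fin r) ℤ).toMonoidHom))
    (by
      intro a b
      rw [AddMonoidAlgebra.lift_apply]
      exact Commute.sum_right _ _ _ fun m _ =>
        (commute_liftLeft_liftMonomial w h a _).smul_right _)

theorem lift_inc (i : Fin s) (a : QTorus₂ (ε i)) :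
    lift w h (inc ε r i a) = liftPair w h i a := by
  rw [lift, inc, AlgHom.comp_apply, Algebra.TensorProduct.includeLeft_apply,
    Algebra.TensorProduct.lift_tmul, map_one, mul_one, liftLeft_single]

theorem monomial_apply (m : Fin r → Multiplicative ℤ) :
    monomial ε r m = 1 ⊗ₜ AddMonoidAlgebra.of K (Fin r → ℤ)
      ((MulEquiv.funMultiplicative (Fin r) ℤ).symm m) := rfl

theorem lift_monomial (m : Fin r → Multiplicative ℤ) :
    lift w h (monomial ε r m) = liftMonomial w h m := by
  rw [lift, monomial_apply, Algebra.TensorProduct.lift_tmul, map_one, one_mul,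
    AddMonoidAlgebra.lift_of, MonoidHom.comp_apply]
  exact congrArg _ (MulEquiv.apply_symm_apply _ m)

theorem lift_x (p : (Fin s × Fin 2) ⊕ Fin r) : lift w h (x ε r p) = w p := by
  rcases p with ⟨i, a⟩ | j
  · exact (lift_inc w h i _).trans (QTorus.lift_x _ _ a)
  · refine (lift_monomial w h _).trans ?_
    exact (MonoidHom.noncommPiCoprod_mulSingle (N := fun _ => Multiplicative ℤ)
      (fun j => (Units.coeHom B).comp (zpowersHom Bˣ (w (Sum.inr j)))) j
      (Multiplicative.ofAdd 1)).trans (by simp)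

end Lift

end BlockTorus

/-- The quantum torus with parameters in block form is a tensor product. -/
theorem nonempty_algEquiv_blockTorus {n : ℕ} (e : Fin n ≃ (Fin s × Fin 2) ⊕ Fin r)
    {q : Matrix (Fin n) (Fin n) Kˣ} (hq : ∀ a b, q a b = blockParam ε r (e a) (e b)) :
    Nonempty (QTorus q ≃ₐ[K] BlockTorus ε r) := by
  have h1 : ∀ a b, SkewCommute (q a b) (BlockTorus.x ε r (e a)) (BlockTorus.x ε r (e b)) :=
    fun a b => hq a b ▸ BlockTorus.skewCommute_x ε r _ _
  have h2 : ∀ p p', SkewCommute (blockParam ε r p p') (QTorus.x q (e.symm p))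
      (QTorus.x q (e.symm p')) := fun p p' => by
    simpa [hq] using QTorus.skewCommute_x q (e.symm p) (e.symm p')
  refine ⟨AlgEquiv.ofAlgHom (QTorus.lift _ h1) (BlockTorus.lift _ h2)
    (BlockTorus.algHom_ext fun p => ?_) (QTorus.algHom_ext fun a => ?_)⟩
  · simp [BlockTorus.lift_x]
  · simp [BlockTorus.lift_x]

end Block

/-! ### Existence of the normal form -/

section Existence

variable {K : Type u} [Field K] {n : ℕ} {q : Matrix (Fin n) (Fin n) Kˣ}

theorem paramGroup_finite (htors : IsMulTorsion (paramGroup q)) : Finite (paramGroup q) := by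
  have hfin : {a | ∃ i j, q i j = a}.Finite := by
    refine (Set.finite_range fun p : Fin n × Fin n => q p.1 p.2).subset ?_
    rintro _ ⟨i, j, rfl⟩
    exact ⟨(i, j), rfl⟩
  have : Group.FG (paramGroup q) :=
    (Group.fg_iff_subgroup_fg _).mpr ⟨hfin.toFinset, by simp [paramGroup]⟩
  exact CommGroup.finite_of_fg_isMulTorsion _ htors

theorem exists_zpowers_eq_paramGroup [Finite (paramGroup q)] :
    ∃ g : Kˣ, Subgroup.zpowers g = paramGroup q := by
  obtain ⟨g, hg⟩ := (isCyclic_subgroup_units (paramGroup q)).exists_generator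
  refine ⟨g, le_antisymm (Subgroup.zpowers_le.mpr g.2) fun a ha => ?_⟩
  obtain ⟨k, hk⟩ := hg ⟨a, ha⟩
  exact ⟨k, by simpa using congrArg Subtype.val hk⟩

theorem mem_paramGroup (i j : Fin n) : q i j ∈ paramGroup q :=
  Subgroup.subset_closure ⟨i, j, rfl⟩

theorem exists_equiv_extending {s : ℕ} {e : Fin s × Fin 2 → Fin n} (he : Function.Injective e) :
    2 * s ≤ n ∧ ∃ f : Fin n ≃ (Fin s × Fin 2) ⊕ Fin (n - 2 * s), ∀ p, f (e p) = Sum.inl p := by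
  classical
  have hle : 2 * s ≤ n := by
    simpa [mul_comm] using Fintype.card_le_of_injective e he
  have hcard : Fintype.card ((Set.range e)ᶜ : Set (Fin n)) = n - 2 * s := by
    rw [Fintype.card_compl_set, Set.card_range_of_injective he]
    simp [mul_comm]
  refine ⟨hle, ((Equiv.Set.sumCompl (Set.range e)).symm.trans
    (Equiv.sumCongr (Equiv.ofInjective e he).symm (Fintype.equivFinOfCardEq hcard))), fun p => ?_⟩
  simp [Equiv.Set.sumCompl_symm_apply_of_mem (Set.mem_range_self p)]

theorem IsBlockForm.apply_eq_blockParam (hq : IsMulAntisymm q) {g : Kˣ} {s : ℕ} {h : Fin s → ℕ}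
    {z : ℕ} {e : Fin s × Fin 2 → Fin n} (H : IsBlockForm q g Finset.univ h z e) {r : ℕ}
    {f : Fin n ≃ (Fin s × Fin 2) ⊕ Fin r} (hf : ∀ p, f (e p) = Sum.inl p) (a b : Fin n) :
    q a b = blockParam (fun i => g ^ normalExp n h z i) r (f a) (f b) := by
  have hcard : (Finset.univ : Finset (Fin n)).card = n := by simp
  have happ := H.apply_eq
  rw [hcard] at happ
  have hf' : ∀ p, f.symm (Sum.inl p) = e p := fun p => by rw [← hf, Equiv.symm_apply_apply]
  obtain ⟨a, rfl⟩ := f.symm.surjective a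
  obtain ⟨b, rfl⟩ := f.symm.surjective b
  rw [Equiv.apply_symm_apply, Equiv.apply_symm_apply]
  by_cases hab : q (f.symm a) (f.symm b) = 1
  · rw [hab]
    rcases a with ⟨i, a⟩ | a <;> rcases b with ⟨j, b⟩ | b
    · rw [hf', hf'] at hab
      simp only [blockParam]
      split_ifs with hij
      · subst hij
        have h1 := happ i
        fin_cases a <;> fin_cases b
        · simp
        · simpa [← h1] using hab.symm
        · simp only [Fin.zero_eta, Fin.mk_one] at hab
          rw [hq.2 (e (i, 0)), h1, inv_eq_one] at hab
          simp [hab]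
        · simp
      · rfl
    · rfl
    · rfl
    · rfl
  · obtain ⟨i, ⟨ha, hb⟩ | ⟨ha, hb⟩⟩ := H.eq_one _ (Finset.mem_univ _) _ (Finset.mem_univ _) hab
    · rw [← hf', f.symm.injective.eq_iff] at ha hb
      subst ha hb
      rw [hf', hf', happ]
      simp [blockParam]
    · rw [← hf', f.symm.injective.eq_iff] at ha hb
      subst ha hb
      rw [hf', hf', hq.2 (e (i, 0)), happ]
      simp [blockParam]

theorem exists_isNormalForm [Finite (paramGroup q)] (hq : IsMulAntisymm q) {g : Kˣ}
    (hg : Subgroup.zpowers g = paramGroup q) :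
    ∃ (s : ℕ) (h : Fin s → ℕ) (z : ℕ), IsNormalForm q g s h z := by
  have hm : Nat.card (paramGroup q) = orderOf g := by rw [← hg, Nat.card_zpowers]
  have hpos : 0 < orderOf g := hm ▸ Nat.card_pos
  obtain ⟨q', s, h, z, e, hr, H, -, hfirst⟩ := exists_reach_isBlockForm hpos n Finset.univ
    (by simp) q hq 1 (one_dvd _) (fun a _ b _ => by
      rw [pow_one, hg]
      exact mem_paramGroup a b)
  obtain ⟨hle, f, hf⟩ := exists_equiv_extending H.injective
  refine ⟨s, h, z, hle, fun i => hm ▸ H.dvd i, fun i => hm ▸ H.lt i, ?_, H.chain, ?_, ?_⟩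
  · intro i hi
    -- All parameters are powers of `g ^ h i`, hence so is `g`; as `h i` divides the order of `g`,
    -- it must be one.
    have hle : paramGroup q ≤ Subgroup.zpowers (g ^ h i) := by
      rw [paramGroup, Subgroup.closure_le]
      rintro _ ⟨a, b, rfl⟩
      exact hfirst i hi a (Finset.mem_univ _) b (Finset.mem_univ _)
    have := dvd_of_pow_mem_zpowers (c := 1) (H.dvd i)
      (hle (hg ▸ (pow_one g).symm ▸ Subgroup.mem_zpowers g))
    exact Nat.dvd_one.mp this
  · simpa using H.order_eq
  · exact ⟨(hr.nonempty_algEquiv hq).some.trans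
      (nonempty_algEquiv_blockTorus _ _ f (H.apply_eq_blockParam (hr.isMulAntisymm hq) hf)).some⟩

end Existence

/-! ### Finite dimension of irreducible representations -/

/-- If `r` acts surjectively, Nakayama's lemma gives an element congruent to 1 modulo `r` that kills
`V`; faithfulness makes it zero, so `r` is a unit. Thus `R` is a field of finite type over `K`, and
Zariski's lemma applies. -/
theorem module_finite_of_finite_faithful_divisible {K R V : Type*} [Field K] [CommRing R]
    [Algebra K R] [Algebra.FiniteType K R] [AddCommGroup V] [Module R V] [Nontrivial V]
    [Module.Finite R V] [FaithfulSMul R V] (h : ∀ r : R, r ≠ 0 → ∀ v : V, ∃ w, r • w = v) :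
    Module.Finite K R := by
  have : Nontrivial R := Module.nontrivial R V
  have hfield : IsField R := by
    refine ⟨exists_pair_ne R, mul_comm, fun {r} hr => ?_⟩
    obtain ⟨t, ht, ht0⟩ := Submodule.exists_sub_one_mem_and_smul_eq_zero_of_fg_of_le_smul
      (Ideal.span {r}) (⊤ : Submodule R V) Module.Finite.fg_top (fun v _ => by
        obtain ⟨w, rfl⟩ := h r hr v
        exact Submodule.smul_mem_smul (Ideal.mem_span_singleton_self r) Submodule.mem_top)
    have ht' : t = 0 := by
      refine FaithfulSMul.eq_of_smul_eq_smul (α := V) fun v => ?_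
      rw [ht0 v Submodule.mem_top, zero_smul]
    rw [ht', zero_sub, neg_mem_iff, Ideal.mem_span_singleton] at ht
    obtain ⟨c, hc⟩ := ht
    exact ⟨c, hc.symm⟩
  let _ := hfield.toField
  exact finite_of_finite_type_of_isJacobsonRing K R

section Irreducible

variable {K : Type*} [Field K] {V : Type*} [AddCommGroup V] [Module K V] {ι : Type*}

/-- A family of endomorphisms of a nonzero space without proper nonzero invariant subspaces. -/
structure IsIrreducibleFamily (T : ι → Module.End K V) : Prop where
  nontrivial : Nontrivial V
  eq_bot_or_eq_top : ∀ W : Submodule K V, (∀ i, ∀ v ∈ W, T i v ∈ W) → W = ⊥ ∨ W = ⊤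

namespace IsIrreducibleFamily

variable {T : ι → Module.End K V}

theorem eq_top (hT : IsIrreducibleFamily T) {W : Submodule K V} (hW : ∀ i, ∀ v ∈ W, T i v ∈ W)
    {v : V} (hv : v ≠ 0) (hvW : v ∈ W) : W = ⊤ :=
  (hT.eq_bot_or_eq_top W hW).resolve_left fun h => hv (by simpa [h] using hvW)

theorem surjective_of_range (hT : IsIrreducibleFamily T) {U : Type*} [AddCommGroup U] [Module K U]
    {f : U →ₗ[K] V} (h0 : f ≠ 0) (h : ∀ i, ∀ u, T i (f u) ∈ LinearMap.range f) :
    Function.Surjective f := by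
  obtain ⟨u, hu⟩ := DFunLike.ne_iff.mp h0
  refine LinearMap.range_eq_top.mp (hT.eq_top ?_ hu ⟨u, rfl⟩)
  rintro i _ ⟨u, rfl⟩
  exact h i u

theorem surjective_of_commute (hT : IsIrreducibleFamily T) {f : Module.End K V} (h0 : f ≠ 0)
    (h : ∀ i, Commute (T i) f) : Function.Surjective f :=
  hT.surjective_of_range h0 fun i u => ⟨T i u, (LinearMap.congr_fun (h i).eq u).symm⟩

theorem eq_smul_of_commute [IsAlgClosed K] [Module.Finite K V] (hT : IsIrreducibleFamily T)
    {f : Module.End K V} (h : ∀ i, Commute (T i) f) : ∃ c : K, ∀ v, f v = c • v := by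
  have := hT.nontrivial
  obtain ⟨c, hc⟩ := Module.End.exists_eigenvalue f
  obtain ⟨v, hv⟩ := hc.exists_hasEigenvector
  refine ⟨c, fun w => ?_⟩
  have := hT.eq_top (W := Module.End.eigenspace f c) (fun i w hw => ?_) hv.2 hv.1
  · exact Module.End.mem_eigenspace_iff.mp (this ▸ Submodule.mem_top)
  · rw [Module.End.mem_eigenspace_iff] at hw ⊢
    have := LinearMap.congr_fun (h i).eq w
    simp only [Module.End.mul_apply] at this
    rw [← this, hw, map_smul]

theorem pow_apply_skew {A B : Module.End K V} {c : K} (h : ∀ v, A (B v) = c • B (A v)) (m : ℕ)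
    (v : V) : A ((B ^ m) v) = c ^ m • (B ^ m) (A v) := by
  induction m generalizing v with
  | zero => simp
  | succ m ih =>
    rw [pow_succ, Module.End.mul_apply, Module.End.mul_apply, ih, h, map_smul, smul_smul, pow_succ]

open scoped IsMulCommutative in
/-- An irreducible family of endomorphisms commuting up to roots of unity acts on a finite
dimensional space. -/
theorem module_finite [Finite ι] (hT : IsIrreducibleFamily T) {c : ι → ι → K}
    (hc : ∀ i j v, T i (T j v) = c i j • T j (T i v)) {m : ℕ} (hm : 0 < m)
    (hcm : ∀ i j, c i j ^ m = 1) : Module.Finite K V := by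
  classical
  have := Fintype.ofFinite ι
  have := hT.nontrivial
  obtain ⟨v₀, hv₀⟩ := exists_ne (0 : V)
  have hcomm : ∀ i j, Commute (T i) (T j ^ m) := fun i j => LinearMap.ext fun v => by
    simpa [hcm] using pow_apply_skew (hc i j) m v
  have hcomm' : ∀ a ∈ Set.range fun i => T i ^ m, ∀ b ∈ Set.range fun i => T i ^ m,
      a * b = b * a := by
    rintro _ ⟨i, rfl⟩ _ ⟨j, rfl⟩
    exact (hcomm i j).pow_left m
  let R := Algebra.adjoin K (Set.range fun i => T i ^ m)
  have : IsMulCommutative R := Algebra.isMulCommutative_adjoin K hcomm'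
  have hR : ∀ (i : ι) (r : R), Commute (T i) (r : Module.End K V) := by
    intro i r
    have : R ≤ Subalgebra.centralizer K {T i} := by
      refine Algebra.adjoin_le ?_
      rintro _ ⟨j, rfl⟩ _ rfl
      exact hcomm i j
    exact this r.2 _ rfl
  have hft : Algebra.FiniteType K R :=
    R.fg_iff_finiteType.mp (Subalgebra.fg_def.mpr ⟨_, Set.finite_range _, rfl⟩)
  let TR : ι → V →ₗ[R] V := fun i =>
    { T i with map_smul' := fun r v => LinearMap.congr_fun (hR i r).eq v }
  have hTR : ∀ i v, TR i v = T i v := fun i v => rfl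
  have hTRpow : ∀ i (a : ℕ) v, (TR i ^ a) v = (T i ^ a) v := by
    intro i a v
    induction a generalizing v with
    | zero => rfl
    | succ a ih => rw [pow_succ, pow_succ, Module.End.mul_apply, Module.End.mul_apply, ih, hTR]
  -- Over `R` it suffices to apply monomials with exponents below `m` to `v₀`. One index is adjoined
  -- at a time: skew commutation preserves invariance under earlier operators, and an exponent
  -- reaching `m` is absorbed by `R`.
  have key : ∀ F : Finset ι, ∃ W : Submodule R V, W.FG ∧ v₀ ∈ W ∧
      ∀ i ∈ F, ∀ w ∈ W, TR i w ∈ W := by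
    intro F
    induction F using Finset.induction_on with
    | empty => exact ⟨Submodule.span R {v₀}, Submodule.fg_span_singleton v₀,
        Submodule.mem_span_singleton_self v₀, by simp⟩
    | insert i F hi ih =>
      obtain ⟨W, hfg, hv, hW⟩ := ih
      have hle : ∀ a : Fin m, W.map (TR i ^ (a : ℕ)) ≤ ⨆ a : Fin m, W.map (TR i ^ (a : ℕ)) :=
        le_iSup (fun a : Fin m => W.map (TR i ^ (a : ℕ)))
      refine ⟨⨆ a : Fin m, W.map (TR i ^ (a : ℕ)), Submodule.fg_iSup _ fun a => hfg.map _,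
        hle ⟨0, hm⟩ ⟨v₀, hv, rfl⟩, fun j hj => ?_⟩
      suffices h : (⨆ a : Fin m, W.map (TR i ^ (a : ℕ))) ≤
          Submodule.comap (TR j) (⨆ a : Fin m, W.map (TR i ^ (a : ℕ))) from fun w hw => h hw
      refine iSup_le ?_
      rintro ⟨a, ha⟩ _ ⟨w, hw, rfl⟩
      rw [Submodule.mem_comap]
      rcases Finset.mem_insert.mp hj with rfl | hj
      · rw [← Module.End.mul_apply, ← pow_succ']
        rcases Nat.lt_or_ge (a + 1) m with h | h
        · exact hle ⟨a + 1, h⟩ ⟨w, hw, rfl⟩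
        · obtain rfl : m = a + 1 := by omega
          let r : R := ⟨T j ^ (a + 1), Algebra.subset_adjoin ⟨j, rfl⟩⟩
          refine hle ⟨0, hm⟩ ⟨r • w, W.smul_mem r hw, ?_⟩
          rw [hTRpow, hTRpow]
          rfl
      · rw [hTRpow, hTR, pow_apply_skew (hc j i)]
        have h1 : (T i ^ a) (T j w) ∈ ⨆ a : Fin m, W.map (TR i ^ (a : ℕ)) :=
          hle ⟨a, ha⟩ ⟨T j w, hW j hj w hw, hTRpow _ _ _⟩
        exact Submodule.smul_mem _ (algebraMap K R (c j i ^ a)) h1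
  obtain ⟨W, hfg, hv, hW⟩ := key Finset.univ
  have htop : W.restrictScalars K = ⊤ :=
    hT.eq_top (fun i w hw => hW i (Finset.mem_univ i) w hw) hv₀ hv
  have : Module.Finite R V := by
    refine ⟨?_⟩
    convert hfg
    exact ((Submodule.restrictScalars_eq_top_iff K R V).mp htop).symm
  -- By Schur's argument, a nonzero element of `R` commutes with the irreducible family and so is
  -- surjective.
  have : Module.Finite K R := by
    refine module_finite_of_finite_faithful_divisible (K := K) (R := R) (V := V) fun r hr => ?_
    exact hT.surjective_of_commute (f := (r : Module.End K V)) (fun h => hr (Subtype.ext h))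
      fun i => hR i r
  exact Module.Finite.trans R V

end IsIrreducibleFamily

end Irreducible

/-! ### Commuting pairs of skew-commuting operators -/

section HeisenbergPairs

variable {K : Type*} [Field K] {V : Type*} [AddCommGroup V] [Module K V] {s : ℕ}
  {ε : Fin s → Kˣ} {X Y : Fin s → Module.End K V}

theorem injective_of_pow_eq_smul {f : Module.End K V} {m : ℕ} (hm : 0 < m) {c : K} (hc : c ≠ 0)
    (h : ∀ v, (f ^ m) v = c • v) : Function.Injective f := by
  rw [injective_iff_map_eq_zero]
  intro v hv
  have := h v
  rw [← Nat.sub_add_cancel hm, pow_succ, Module.End.mul_apply, hv, map_zero] at this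
  exact (smul_eq_zero.mp this.symm).resolve_left hc

/-- The space spanned by the monomials in the `X i` applied to a joint eigenvector of the `Y i`. -/
theorem exists_invariant_submodule
    (hXX : ∀ i j v, X i (X j v) = X j (X i v))
    (hYX : ∀ i j v, Y j (X i v) = (if i = j then (ε i : K) else 1) • X i (Y j v))
    (hk : ∀ i, 0 < orderOf (ε i)) {c : Fin s → K} (hc : ∀ i, c i ≠ 0)
    (hX : ∀ i v, (X i ^ orderOf (ε i)) v = c i • v) {μ : Fin s → K} (hμ : ∀ i, μ i ≠ 0)
    {v : V} (hv : v ≠ 0) (hYv : ∀ j, Y j v = μ j • v) (F : Finset (Fin s)) :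
    ∃ W : Submodule K V, v ∈ W ∧ Module.Finite K W ∧
      Module.finrank K W = ∏ i ∈ F, orderOf (ε i) ∧ (∀ i ∈ F, ∀ w ∈ W, X i w ∈ W) ∧
      (∀ j, ∀ w ∈ W, Y j w ∈ W) ∧ ∀ j, j ∉ F → ∀ w ∈ W, Y j w = μ j • w := by
  induction F using Finset.induction_on with
  | empty =>
    have hspan : ∀ j, ∀ w ∈ Submodule.span K {v}, Y j w = μ j • w := by
      intro j w hw
      obtain ⟨a, rfl⟩ := Submodule.mem_span_singleton.mp hw
      rw [map_smul, hYv, smul_comm]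
    refine ⟨Submodule.span K {v}, Submodule.mem_span_singleton_self v, inferInstance, ?_, by simp,
      fun j w hw => ?_, fun j _ => hspan j⟩
    · simpa using finrank_span_singleton hv
    · rw [hspan j w hw]
      exact Submodule.smul_mem _ _ hw
  | insert i F hi ih =>
    obtain ⟨W, hvW, hfin, hrank, hXW, hYW, hμW⟩ := ih
    let Φ : (Fin (orderOf (ε i)) → W) →ₗ[K] V :=
      ∑ a : Fin (orderOf (ε i)), (X i ^ (a : ℕ)) ∘ₗ W.subtype ∘ₗ LinearMap.proj a
    have hΦ : ∀ w, Φ w = ∑ a : Fin (orderOf (ε i)), (X i ^ (a : ℕ)) (w a : V) := by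
      intro w
      simp [Φ]
    have hYXpow : ∀ j (a : ℕ) w, Y j ((X i ^ a) w) =
        (if i = j then (ε i : K) else 1) ^ a • (X i ^ a) (Y j w) := fun j a w =>
      IsIrreducibleFamily.pow_apply_skew (hYX i j) a w
    have hYiX : ∀ (a : ℕ) (w : W), Y i ((X i ^ a) (w : V)) =
        ((ε i : K) ^ a * μ i) • (X i ^ a) (w : V) := by
      intro a w
      rw [hYXpow, if_pos rfl, hμW i hi w w.2, map_smul, smul_smul]
    have hXinj := injective_of_pow_eq_smul (hk i) (hc i) (hX i)
    have hXpow : ∀ a : ℕ, Function.Injective (X i ^ a) := fun a => by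
      rw [Module.End.coe_pow]
      exact hXinj.iterate a
    have hinjε : Function.Injective fun a : Fin (orderOf (ε i)) => (ε i : K) ^ (a : ℕ) * μ i := by
      intro a b hab
      have h1 : (ε i : K) ^ (a : ℕ) = (ε i : K) ^ (b : ℕ) := mul_right_cancel₀ (hμ i) hab
      have h2 : (ε i) ^ (a : ℕ) = (ε i) ^ (b : ℕ) := Units.ext (by simpa using h1)
      exact Fin.ext (pow_injOn_Iio_orderOf a.2 b.2 h2)
    -- On the image of `W` under `X i ^ a` the operator `Y i` is the scalar `ε i ^ a * μ i`. These
    -- are distinct for `a < orderOf (ε i)`, so the sum is direct and the dimension is multiplied by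
    -- `orderOf (ε i)`.
    have hind := (Module.End.eigenspaces_iSupIndep (Y i)).comp hinjε
    have hΦinj : Function.Injective Φ := by
      rw [injective_iff_map_eq_zero]
      intro w hw
      rw [hΦ] at hw
      funext a
      have := (iSupIndep_iff_finsetSum_eq_zero_imp_eq_zero _).mp hind Finset.univ
        (fun a => (X i ^ (a : ℕ)) (w a : V))
        (fun a _ => Module.End.mem_eigenspace_iff.mpr (hYiX a (w a))) hw a (Finset.mem_univ a)
      exact Subtype.ext (hXpow a (this.trans (map_zero _).symm))
    have hmem : ∀ a < orderOf (ε i), ∀ w ∈ W, (X i ^ a) w ∈ LinearMap.range Φ := by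
      intro a ha w hw
      refine ⟨Pi.single ⟨a, ha⟩ ⟨w, hw⟩, ?_⟩
      rw [hΦ, Finset.sum_eq_single ⟨a, ha⟩]
      · simp
      · intro b _ hb
        simp [Pi.single_eq_of_ne hb]
      · simp
    have hinv : ∀ f : Module.End K V, (∀ a < orderOf (ε i), ∀ w ∈ W,
        f ((X i ^ a) w) ∈ LinearMap.range Φ) → ∀ w ∈ LinearMap.range Φ, f w ∈ LinearMap.range Φ := by
      rintro f hf _ ⟨w, rfl⟩
      rw [hΦ, map_sum]
      exact Submodule.sum_mem _ fun a _ => hf a a.2 _ (w a).2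
    refine ⟨LinearMap.range Φ, ?_, inferInstance, ?_, ?_, ?_, ?_⟩
    · simpa using hmem 0 (hk i) v hvW
    · rw [LinearMap.finrank_range_of_inj hΦinj, Module.finrank_pi_fintype, Finset.prod_insert hi,
        ← hrank]
      simp
    · intro j hj
      refine hinv _ fun a ha w hw => ?_
      rcases Finset.mem_insert.mp hj with rfl | hj
      · rw [← Module.End.mul_apply, ← pow_succ']
        rcases Nat.lt_or_ge (a + 1) (orderOf (ε j)) with h | h
        · exact hmem _ h w hw
        · rw [show a + 1 = orderOf (ε j) by omega, hX]
          exact Submodule.smul_mem _ _ (by simpa using hmem 0 (hk j) w hw)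
      · have : X j ((X i ^ a) w) = (X i ^ a) (X j w) := by
          have := IsIrreducibleFamily.pow_apply_skew (A := X j) (B := X i) (c := 1)
            (fun v => by rw [one_smul, hXX]) a w
          simpa using this
        rw [this]
        exact hmem a ha _ (hXW j hj w hw)
    · intro j
      refine hinv _ fun a ha w hw => ?_
      rw [hYXpow]
      exact Submodule.smul_mem _ _ (hmem a ha _ (hYW j w hw))
    · rintro j hj _ ⟨w, rfl⟩
      rw [Finset.mem_insert, not_or] at hj
      rw [hΦ, map_sum, Finset.smul_sum]
      refine Finset.sum_congr rfl fun a _ => ?_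
      rw [hYXpow, if_neg (Ne.symm hj.1), one_pow, one_smul, hμW j hj.2 _ (w a).2, map_smul]

/-- Commuting endomorphisms `Y j` have a joint eigenvector with prescribed eigenvalues, as the
eigenvalues are permuted by the `X i`. -/
theorem exists_joint_eigenvector [IsAlgClosed K] [Module.Finite K V] [Nontrivial V]
    (hYY : ∀ i j v, Y i (Y j v) = Y j (Y i v))
    (hYX : ∀ i j v, Y j (X i v) = (if i = j then (ε i : K) else 1) • X i (Y j v))
    (hk : ∀ i, 0 < orderOf (ε i)) (hX : ∀ i, Function.Injective (X i)) {μ : Fin s → K}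
    (hμ : ∀ i, μ i ≠ 0) (hY : ∀ i v, (Y i ^ orderOf (ε i)) v = μ i ^ orderOf (ε i) • v) :
    ∃ v ≠ 0, ∀ j, Y j v = μ j • v := by
  suffices h : ∀ F : Finset (Fin s), ∃ v : V, v ≠ 0 ∧ ∀ j ∈ F, Y j v = μ j • v by
    obtain ⟨v, hv, h⟩ := h Finset.univ
    exact ⟨v, hv, fun j => h j (Finset.mem_univ j)⟩
  intro F
  induction F using Finset.induction_on with
  | empty =>
    obtain ⟨v, hv⟩ := exists_ne (0 : V)
    exact ⟨v, hv, by simp⟩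
  | insert i F hi ih =>
    obtain ⟨v, hv, hvF⟩ := ih
    let E : Submodule K V := ⨅ j ∈ F, Module.End.eigenspace (Y j) (μ j)
    have hE : ∀ w, w ∈ E ↔ ∀ j ∈ F, Y j w = μ j • w := by
      intro w
      simp [E, Submodule.mem_iInf]
    have hYE : ∀ w ∈ E, Y i w ∈ E := by
      intro w hw
      rw [hE] at hw ⊢
      intro j hj
      rw [hYY, hw j hj, map_smul]
    have : Nontrivial E := ⟨⟨v, (hE v).mpr hvF⟩, 0, fun h => hv (congrArg Subtype.val h)⟩
    obtain ⟨l, hl⟩ := Module.End.exists_eigenvalue ((Y i).restrict hYE)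
    obtain ⟨w, hw⟩ := hl.exists_hasEigenvector
    have hw0 : (w : V) ≠ 0 := fun h => hw.2 (Subtype.ext h)
    have hYw : Y i w = l • (w : V) := congrArg Subtype.val hw.apply_eq_smul
    have hpow : ∀ a : ℕ, (Y i ^ a) (w : V) = l ^ a • (w : V) := by
      intro a
      induction a with
      | zero => simp
      | succ a ih => rw [pow_succ, Module.End.mul_apply, hYw, map_smul, ih, smul_smul, pow_succ']
    have hlμ : l ^ orderOf (ε i) = μ i ^ orderOf (ε i) :=
      smul_left_injective K hw0 ((hpow _).symm.trans (hY i w))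
    have hl0 : l ≠ 0 := by
      rintro rfl
      rw [zero_pow (hk i).ne'] at hlμ
      exact pow_ne_zero _ (hμ i) hlμ.symm
    have hprim : IsPrimitiveRoot (ε i : K) (orderOf (ε i)) :=
      IsPrimitiveRoot.coe_units_iff.mpr (IsPrimitiveRoot.orderOf (ε i))
    have : NeZero (orderOf (ε i)) := ⟨(hk i).ne'⟩
    -- The eigenvalue found and the prescribed one have the same power of exponent `orderOf (ε i)`,
    -- so they differ by some `ε i ^ a`; applying `X i ^ a` corrects this and keeps the eigenvalues
    -- of the other `Y j`.
    obtain ⟨a, -, ha⟩ := hprim.eq_pow_of_pow_eq_one (ξ := μ i / l) (by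
      rw [div_pow, hlμ, div_self (pow_ne_zero _ (hμ i))])
    refine ⟨(X i ^ a) w, ?_, fun j hj => ?_⟩
    · have hinj : Function.Injective (X i ^ a) := by
        rw [Module.End.coe_pow]
        exact (hX i).iterate a
      exact fun h => hw0 (hinj (h.trans (map_zero _).symm))
    · rw [IsIrreducibleFamily.pow_apply_skew (hYX i j) a]
      rcases Finset.mem_insert.mp hj with rfl | hj
      · rw [if_pos rfl, hYw, map_smul, smul_smul, ha, div_mul_cancel₀ _ hl0]
      · rw [if_neg (fun h : i = j => hi (h ▸ hj)), one_pow, one_smul, (hE w).mp w.2 j hj, map_smul]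

end HeisenbergPairs

/-! ### Representations of a block torus and their central characters -/

section BlockRep

variable {K : Type*} [Field K] {s : ℕ} {ε : Fin s → Kˣ} {r : ℕ}
  {V : Type*} [AddCommGroup V] [Module K V] {T : (Fin s × Fin 2) ⊕ Fin r → Module.End K V}
  {V' : Type*} [AddCommGroup V'] [Module K V'] {T' : (Fin s × Fin 2) ⊕ Fin r → Module.End K V'}

/-- The exponents of the central powers of the generators. -/
noncomputable def centralExp (ε : Fin s → Kˣ) (r : ℕ) : (Fin s × Fin 2) ⊕ Fin r → ℕ :=
  Sum.elim (fun p => orderOf (ε p.1)) fun _ => 1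

/-- A right representation of a block quantum torus. -/
structure IsBlockRep (ε : Fin s → Kˣ) (T : (Fin s × Fin 2) ⊕ Fin r → Module.End K V) : Prop where
  skew : ∀ p p' v, T p' (T p v) = (blockParam ε r p p' : K) • T p (T p' v)
  injective : ∀ p, Function.Injective (T p)

/-- The central powers of the generators act as the scalars `θ`. -/
def HasCentralChar (ε : Fin s → Kˣ) (T : (Fin s × Fin 2) ⊕ Fin r → Module.End K V)
    (θ : (Fin s × Fin 2) ⊕ Fin r → Kˣ) : Prop :=
  ∀ p v, (T p ^ centralExp ε r p) v = (θ p : K) • v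

theorem blockParam_pow_centralExp (p p' : (Fin s × Fin 2) ⊕ Fin r) :
    (blockParam ε r p p') ^ centralExp ε r p = 1 := by
  rcases p with ⟨i, a⟩ | i <;> rcases p' with ⟨j, b⟩ | j
  · simp only [blockParam, centralExp, Sum.elim_inl]
    split_ifs
    · fin_cases a <;> fin_cases b <;> simp [pow_orderOf_eq_one]
    · simp
  all_goals simp [blockParam]

namespace IsBlockRep

theorem exists_hasCentralChar [IsAlgClosed K] [Module.Finite K V] (hT : IsBlockRep ε T)
    (hirr : IsIrreducibleFamily T) : ∃ θ, HasCentralChar ε T θ := by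
  have h : ∀ p, ∃ c : K, ∀ v, (T p ^ centralExp ε r p) v = c • v := fun p =>
    hirr.eq_smul_of_commute fun p' => LinearMap.ext fun v => by
      have := IsIrreducibleFamily.pow_apply_skew (hT.skew p p') (centralExp ε r p) v
      rwa [← Units.val_pow_eq_pow_val, blockParam_pow_centralExp, Units.val_one, one_smul] at this
  choose c hc using h
  have hc0 : ∀ p, c p ≠ 0 := by
    intro p hp
    have := hirr.nontrivial
    obtain ⟨v, hv⟩ := exists_ne (0 : V)
    refine hv ?_
    have hinj : Function.Injective (T p ^ centralExp ε r p) := by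
      rw [Module.End.coe_pow]
      exact (hT.injective p).iterate _
    exact hinj (by rw [hc, hp, zero_smul, map_zero])
  exact ⟨fun p => Units.mk0 (c p) (hc0 p), hc⟩

variable {θ : (Fin s × Fin 2) ⊕ Fin r → Kˣ}

theorem apply_X_X (hT : IsBlockRep ε T) (a : Fin 2) (i j : Fin s) (v : V) :
    T (Sum.inl (i, a)) (T (Sum.inl (j, a)) v) = T (Sum.inl (j, a)) (T (Sum.inl (i, a)) v) := by
  have := hT.skew (Sum.inl (j, a)) (Sum.inl (i, a)) v
  rw [this]
  simp only [blockParam]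
  fin_cases a <;> split_ifs <;> simp

theorem apply_Y_X (hT : IsBlockRep ε T) (i j : Fin s) (v : V) :
    T (Sum.inl (j, 1)) (T (Sum.inl (i, 0)) v) =
      (if i = j then (ε i : K) else 1) • T (Sum.inl (i, 0)) (T (Sum.inl (j, 1)) v) := by
  rw [hT.skew (Sum.inl (i, 0)) (Sum.inl (j, 1)) v]
  simp only [blockParam]
  split_ifs <;> simp

theorem exists_joint_eigenvector [IsAlgClosed K] [Module.Finite K V] [Nontrivial V]
    (hT : IsBlockRep ε T) (hk : ∀ i, 0 < orderOf (ε i)) (hθ : HasCentralChar ε T θ)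
    {μ : Fin s → K} (hμ : ∀ i, μ i ^ orderOf (ε i) = θ (Sum.inl (i, 1))) :
    ∃ v ≠ 0, ∀ j, T (Sum.inl (j, 1)) v = μ j • v :=
  QuantumSpace.exists_joint_eigenvector (hT.apply_X_X 1) hT.apply_Y_X hk
    (fun i => hT.injective _)
    (fun i h => by
      have := hμ i
      rw [h, zero_pow (hk i).ne'] at this
      exact (θ _).ne_zero this.symm)
    (fun i v => by rw [hμ]; exact hθ (Sum.inl (i, 1)) v)

theorem exists_invariant (hT : IsBlockRep ε T) (hk : ∀ i, 0 < orderOf (ε i))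
    (hθ : HasCentralChar ε T θ) {μ : Fin s → K}
    (hμ : ∀ i, μ i ^ orderOf (ε i) = θ (Sum.inl (i, 1))) {v : V} (hv : v ≠ 0)
    (hv' : ∀ j, T (Sum.inl (j, 1)) v = μ j • v) :
    ∃ W : Submodule K V, v ∈ W ∧ Module.Finite K W ∧
      Module.finrank K W = ∏ i, orderOf (ε i) ∧ ∀ p, ∀ w ∈ W, T p w ∈ W := by
  obtain ⟨W, hvW, hfin, hrank, hX, hY, -⟩ := exists_invariant_submodule (hT.apply_X_X 0)
    hT.apply_Y_X hk (c := fun i => θ (Sum.inl (i, 0))) (fun i => (θ _).ne_zero)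
    (fun i v => hθ (Sum.inl (i, 0)) v) (μ := μ)
    (fun i h => by
      have := hμ i
      rw [h, zero_pow (hk i).ne'] at this
      exact (θ _).ne_zero this.symm) hv hv' Finset.univ
  refine ⟨W, hvW, hfin, hrank, ?_⟩
  rintro (⟨i, a⟩ | j) w hw
  · fin_cases a
    · exact hX i (Finset.mem_univ i) w hw
    · exact hY i w hw
  · have := hθ (Sum.inr j) w
    simp only [centralExp, Sum.elim_inr, pow_one] at this
    rw [this]
    exact W.smul_mem _ hw

theorem exists_roots [IsAlgClosed K] (hk : ∀ i, 0 < orderOf (ε i))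
    (θ : (Fin s × Fin 2) ⊕ Fin r → Kˣ) :
    ∃ μ : Fin s → K, ∀ i, μ i ^ orderOf (ε i) = θ (Sum.inl (i, 1)) := by
  choose μ hμ using fun i => IsAlgClosed.exists_pow_nat_eq (θ (Sum.inl (i, 1)) : K) (hk i)
  exact ⟨μ, hμ⟩

/-- The dimension of an irreducible representation of a block quantum torus. -/
theorem finrank_eq [IsAlgClosed K] [Module.Finite K V] (hT : IsBlockRep ε T)
    (hirr : IsIrreducibleFamily T) (hk : ∀ i, 0 < orderOf (ε i)) :
    Module.finrank K V = ∏ i, orderOf (ε i) := by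
  have := hirr.nontrivial
  obtain ⟨θ, hθ⟩ := hT.exists_hasCentralChar hirr
  obtain ⟨μ, hμ⟩ := exists_roots hk θ
  obtain ⟨v, hv, hv'⟩ := hT.exists_joint_eigenvector hk hθ hμ
  obtain ⟨W, hvW, -, hrank, hW⟩ := hT.exists_invariant hk hθ hμ hv hv'
  rw [← hrank, hirr.eq_top hW hv hvW, finrank_top]

/-- An irreducible representation of a block quantum torus is determined by its central
character. -/
theorem exists_linearEquiv [IsAlgClosed K] [Module.Finite K V] [Module.Finite K V']
    (hT : IsBlockRep ε T) (hirr : IsIrreducibleFamily T) (hT' : IsBlockRep ε T')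
    (hirr' : IsIrreducibleFamily T') (hk : ∀ i, 0 < orderOf (ε i)) (hθ : HasCentralChar ε T θ)
    (hθ' : HasCentralChar ε T' θ) : ∃ e : V ≃ₗ[K] V', ∀ p v, e (T p v) = T' p (e v) := by
  have := hirr.nontrivial
  have := hirr'.nontrivial
  obtain ⟨μ, hμ⟩ := exists_roots hk θ
  obtain ⟨v, hv, hYv⟩ := hT.exists_joint_eigenvector hk hθ hμ
  obtain ⟨v', hv', hYv'⟩ := hT'.exists_joint_eigenvector hk hθ' hμ
  -- Both eigenvectors have the same eigenvalues, so `(v, v')` generates an invariant subspace `W`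
  -- of `V × V'` of dimension `∏ i, orderOf (ε i)`. Each projection is onto by irreducibility and
  -- injective by dimension: `W` is the graph of the isomorphism.
  let S : (Fin s × Fin 2) ⊕ Fin r → Module.End K (V × V') := fun p => (T p).prodMap (T' p)
  have hS : IsBlockRep ε S := ⟨fun p p' w => Prod.ext (hT.skew p p' w.1) (hT'.skew p p' w.2),
    fun p => (hT.injective p).prodMap (hT'.injective p)⟩
  have hSpow : ∀ p (m : ℕ) w, (S p ^ m) w = ((T p ^ m) w.1, (T' p ^ m) w.2) := by
    intro p m w
    induction m generalizing w with
    | zero => rfl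
    | succ m ih => rw [pow_succ, pow_succ, pow_succ, Module.End.mul_apply, ih]; rfl
  have hSθ : HasCentralChar ε S θ := fun p w => by
    rw [hSpow, hθ, hθ']
    rfl
  obtain ⟨W, hvW, hfin, hrank, hW⟩ := hS.exists_invariant hk hSθ hμ (v := (v, v'))
    (fun h => hv (congrArg Prod.fst h))
    (fun j => Prod.ext (hYv j) (hYv' j))
  let f : W →ₗ[K] V := (LinearMap.fst K V V') ∘ₗ W.subtype
  let f' : W →ₗ[K] V' := (LinearMap.snd K V V') ∘ₗ W.subtype
  have hf : Function.Surjective f := hirr.surjective_of_range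
    (fun h => hv (LinearMap.congr_fun h ⟨_, hvW⟩)) fun p w => ⟨⟨S p w, hW p w w.2⟩, rfl⟩
  have hf' : Function.Surjective f' := hirr'.surjective_of_range
    (fun h => hv' (LinearMap.congr_fun h ⟨_, hvW⟩)) fun p w => ⟨⟨S p w, hW p w w.2⟩, rfl⟩
  have hinj : Function.Injective f := (LinearMap.injective_iff_surjective_of_finrank_eq_finrank
    (hrank.trans (hT.finrank_eq hirr hk).symm)).mpr hf
  have hinj' : Function.Injective f' := (LinearMap.injective_iff_surjective_of_finrank_eq_finrank
    (hrank.trans (hT'.finrank_eq hirr' hk).symm)).mpr hf'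
  let g := LinearEquiv.ofBijective f ⟨hinj, hf⟩
  let g' := LinearEquiv.ofBijective f' ⟨hinj', hf'⟩
  refine ⟨g.symm.trans g', fun p w => ?_⟩
  obtain ⟨w, rfl⟩ := g.surjective w
  have : T p (g w) = g ⟨S p w, hW p w w.2⟩ := rfl
  rw [this, LinearEquiv.trans_apply, LinearEquiv.trans_apply, LinearEquiv.symm_apply_apply,
    LinearEquiv.symm_apply_apply]
  rfl

end IsBlockRep

end BlockRep

/-! ### Right representations of the quantum torus -/

section RightRepresentations

variable {K : Type u} [Field K] {n : ℕ} {q q' : Matrix (Fin n) (Fin n) Kˣ}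
  {V : Type*} [AddCommGroup V] [Module K V] {V' : Type*} [AddCommGroup V'] [Module K V']

namespace QTorus

/-- The action of the generators in a right representation of a quantum torus. -/
noncomputable def genAction (ρ : QTorus q →ₐ[K] (Module.End K V)ᵐᵒᵖ) (i : Fin n) : Module.End K V :=
  (ρ (x q i)).unop

theorem genAction_skew (ρ : QTorus q →ₐ[K] (Module.End K V)ᵐᵒᵖ) (i j : Fin n) (v : V) :
    genAction ρ j (genAction ρ i v) = (q i j : K) • genAction ρ i (genAction ρ j v) := by
  have h := congrArg MulOpposite.unop (congrArg ρ (skewCommute_iff.mp (skewCommute_x q i j)))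
  rw [map_smul, map_mul, map_mul] at h
  exact LinearMap.congr_fun h v

theorem genAction_bijective (ρ : QTorus q →ₐ[K] (Module.End K V)ᵐᵒᵖ) (i : Fin n) :
    Function.Bijective (genAction ρ i) := by
  rw [← Module.End.isUnit_iff]
  exact ((x q i).isUnit.map ρ).unop

theorem apply_mem_of_genAction_mem [Module.Finite K V] (ρ : QTorus q →ₐ[K] (Module.End K V)ᵐᵒᵖ)
    {W : Submodule K V} (hW : ∀ i, ∀ w ∈ W, genAction ρ i w ∈ W) (a : QTorus q) :
    ∀ w ∈ W, (ρ a).unop w ∈ W := by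
  have ha : a ∈ Algebra.adjoin K (Set.range (fun i => (x q i : QTorus q)) ∪
      Set.range (fun i => (↑(x q i)⁻¹ : QTorus q))) := (adjoin_x_eq_top (q := q)).symm ▸ Algebra.mem_top
  induction ha using Algebra.adjoin_induction with
  | mem a ha =>
    rcases ha with ⟨i, rfl⟩ | ⟨i, rfl⟩
    · exact hW i
    · intro w hw
      -- Finite dimension enters here: an injective operator preserving `W` maps `W` onto itself, so
      -- its inverse preserves `W` as well.
      have hsurj : Function.Surjective ((genAction ρ i).restrict (hW i)) := by
        refine LinearMap.surjective_of_injective fun u u' h => Subtype.ext ?_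
        exact (genAction_bijective ρ i).1 (congrArg Subtype.val h)
      obtain ⟨u, hu⟩ := hsurj ⟨w, hw⟩
      have hu' : genAction ρ i u = w := congrArg Subtype.val hu
      have h1 : (ρ ↑(x q i)⁻¹).unop (genAction ρ i (u : V)) = u := by
        have h := congrArg MulOpposite.unop (congrArg ρ (x q i).mul_inv)
        rw [map_mul, map_one] at h
        exact LinearMap.congr_fun h (u : V)
      rw [hu'] at h1
      change (ρ ↑(x q i)⁻¹).unop w ∈ W
      rw [h1]
      exact u.2
  | algebraMap c =>
    intro w hw
    rw [AlgHom.commutes]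
    exact W.smul_mem c hw
  | add a b _ _ iha ihb =>
    intro w hw
    rw [map_add]
    exact W.add_mem (iha w hw) (ihb w hw)
  | mul a b _ _ iha ihb =>
    intro w hw
    rw [map_mul]
    exact ihb _ (iha w hw)

/-- Invariance under one set of generators amounts to invariance under the whole torus, so
irreducibility survives the passage to the generators of an isomorphic torus. -/
theorem isIrreducibleFamily_comp [Module.Finite K V] {ρ : QTorus q →ₐ[K] (Module.End K V)ᵐᵒᵖ}
    (hρ : IsIrreducibleFamily (genAction ρ)) (φ : QTorus q ≃ₐ[K] QTorus q') :
    IsIrreducibleFamily (genAction (ρ.comp (φ.symm : QTorus q' →ₐ[K] QTorus q))) := by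
  refine ⟨hρ.nontrivial, fun W hW => hρ.eq_bot_or_eq_top W fun i w hw => ?_⟩
  have := apply_mem_of_genAction_mem _ hW (φ (x q i)) w hw
  simpa [genAction] using this

theorem apply_eq_of_genAction_eq {ρ : QTorus q →ₐ[K] (Module.End K V)ᵐᵒᵖ}
    {ρ' : QTorus q →ₐ[K] (Module.End K V')ᵐᵒᵖ} (e : V ≃ₗ[K] V')
    (h : ∀ i v, e (genAction ρ i v) = genAction ρ' i (e v)) (a : QTorus q) (v : V) :
    e ((ρ a).unop v) = (ρ' a).unop (e v) := by
  have : (AlgEquiv.op (e.conjAlgEquiv K) : _ →ₐ[K] (Module.End K V')ᵐᵒᵖ).comp ρ = ρ' := by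
    refine algHom_ext fun i => MulOpposite.unop_injective (LinearMap.ext fun w => ?_)
    have := h i (e.symm w)
    rw [LinearEquiv.apply_symm_apply] at this
    exact this
  rw [← this]
  simp [LinearEquiv.conjAlgEquiv]

end QTorus

theorem exists_genAction_eq [IsAlgClosed K] {T : Fin n → Module.End K V}
    (hT : ∀ i j v, T j (T i v) = (q i j : K) • T i (T j v)) (hbij : ∀ i, Function.Bijective (T i)) :
    ∃ ρ : QTorus q →ₐ[K] (Module.End K V)ᵐᵒᵖ, QTorus.genAction ρ = T := by
  let w : Fin n → ((Module.End K V)ᵐᵒᵖ)ˣ := fun i =>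
    ((Module.End.isUnit_iff (T i)).mpr (hbij i)).op.unit
  have hw : ∀ i j, SkewCommute (q i j) (w i) (w j) := fun i j => skewCommute_iff.mpr
    (MulOpposite.unop_injective (LinearMap.ext (hT i j)))
  refine ⟨QTorus.lift w hw, funext fun i => ?_⟩
  rw [QTorus.genAction, QTorus.lift_x]
  rfl

end RightRepresentations

/-! ### Simple modules over quantum affine space -/

section AffineModules

variable {K : Type u} [Field K] {n : ℕ} {q : Matrix (Fin n) (Fin n) Kˣ}

theorem QAffine.op_smul_mem {M : Type*} [AddCommGroup M] [Module (QAffine q)ᵐᵒᵖ M] [Module K M]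
    [IsScalarTower K (QAffine q)ᵐᵒᵖ M] {W : Submodule K M}
    (hW : ∀ i, ∀ w ∈ W, MulOpposite.op (QAffine.x q i) • w ∈ W) (a : QAffine q) :
    ∀ w ∈ W, MulOpposite.op a • w ∈ W := by
  have ha : a ∈ Algebra.adjoin K (Set.range (QAffine.x q)) :=
    (QAffine.adjoin_x_eq_top (q := q)).symm ▸ Algebra.mem_top
  induction ha using Algebra.adjoin_induction with
  | mem a ha =>
    obtain ⟨i, rfl⟩ := ha
    exact hW i
  | algebraMap c =>
    intro w hw
    rw [← MulOpposite.algebraMap_apply, algebraMap_smul]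
    exact W.smul_mem c hw
  | add a b _ _ iha ihb =>
    intro w hw
    rw [MulOpposite.op_add, add_smul]
    exact W.add_mem (iha w hw) (ihb w hw)
  | mul a b _ _ iha ihb =>
    intro w hw
    rw [MulOpposite.op_mul, mul_smul]
    exact ihb _ (iha w hw)

theorem QAffine.map_op_smul {M N : Type*} [AddCommGroup M] [Module (QAffine q)ᵐᵒᵖ M] [Module K M]
    [IsScalarTower K (QAffine q)ᵐᵒᵖ M] [AddCommGroup N] [Module (QAffine q)ᵐᵒᵖ N] [Module K N]
    [IsScalarTower K (QAffine q)ᵐᵒᵖ N] (f : M →ₗ[K] N)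
    (hf : ∀ i v, f (MulOpposite.op (QAffine.x q i) • v) = MulOpposite.op (QAffine.x q i) • f v)
    (a : QAffine q) : ∀ v, f (MulOpposite.op a • v) = MulOpposite.op a • f v := by
  have ha : a ∈ Algebra.adjoin K (Set.range (QAffine.x q)) :=
    (QAffine.adjoin_x_eq_top (q := q)).symm ▸ Algebra.mem_top
  induction ha using Algebra.adjoin_induction with
  | mem a ha =>
    obtain ⟨i, rfl⟩ := ha
    exact hf i
  | algebraMap c =>
    intro v
    rw [← MulOpposite.algebraMap_apply, algebraMap_smul, algebraMap_smul, map_smul]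
  | add a b _ _ iha ihb =>
    intro v
    rw [MulOpposite.op_add, add_smul, add_smul, map_add, iha, ihb]
  | mul a b _ _ iha ihb =>
    intro v
    rw [MulOpposite.op_mul, mul_smul, mul_smul, ihb, iha]

theorem pow_card_paramGroup (i j : Fin n) : q i j ^ Nat.card (paramGroup q) = 1 :=
  congrArg Subtype.val
    (pow_card_eq_one' : (⟨q i j, mem_paramGroup i j⟩ : paramGroup q) ^ Nat.card (paramGroup q) = 1)

namespace SimpleMod

/-- The action of the ground field on a module over quantum affine space. -/
@[reducible]
def moduleBase (M : SimpleMod q) : Module K M.carrier :=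
  Module.compHom M.carrier (algebraMap K (QAffine q)ᵐᵒᵖ)

attribute [local instance] moduleBase

instance isScalarTower (M : SimpleMod q) : IsScalarTower K (QAffine q)ᵐᵒᵖ M.carrier :=
  ⟨fun c a v => by
    rw [Algebra.smul_def, mul_smul]
    rfl⟩

/-- The action of the generators on a module over quantum affine space. -/
noncomputable def genAction (M : SimpleMod q) (i : Fin n) : Module.End K M.carrier :=
  Algebra.lsmul K K M.carrier (MulOpposite.op (QAffine.x q i))

theorem genAction_apply (M : SimpleMod q) (i : Fin n) (v : M.carrier) :
    M.genAction i v = MulOpposite.op (QAffine.x q i) • v := rfl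

theorem genAction_skew (M : SimpleMod q) (i j : Fin n) (v : M.carrier) :
    M.genAction j (M.genAction i v) = (q i j : K) • M.genAction i (M.genAction j v) := by
  simp only [genAction_apply]
  rw [← mul_smul, ← MulOpposite.op_mul, QAffine.x_mul_x, MulOpposite.op_smul, smul_assoc,
    MulOpposite.op_mul, mul_smul]

theorem isIrreducibleFamily (M : SimpleMod q) : IsIrreducibleFamily M.genAction := by
  have := M.simple
  refine ⟨IsSimpleModule.nontrivial (QAffine q)ᵐᵒᵖ M.carrier, fun W hW => ?_⟩
  let N : Submodule (QAffine q)ᵐᵒᵖ M.carrier :=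
    { W with smul_mem' := fun a w hw => QAffine.op_smul_mem hW a.unop w hw }
  have hN : N.restrictScalars K = W := rfl
  rcases eq_bot_or_eq_top N with h | h
  · left
    rw [← hN, h, Submodule.restrictScalars_bot]
  · right
    rw [← hN, h, Submodule.restrictScalars_top]

/-- Skew commutation makes the kernel and the range of a variable submodules. The variable acts
nontrivially, so by simplicity the kernel is zero and the range is everything. -/
theorem genAction_bijective (M : SimpleMod q) (i : Fin n) :
    Function.Bijective (M.genAction i) := by
  have hirr := M.isIrreducibleFamily
  obtain ⟨v, hv⟩ := M.nontrivial i
  constructor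
  · rw [← LinearMap.ker_eq_bot]
    refine (hirr.eq_bot_or_eq_top _ fun j w hw => ?_).resolve_right fun h => hv ?_
    · rw [LinearMap.mem_ker] at hw ⊢
      rw [M.genAction_skew, hw, map_zero, smul_zero]
    · exact LinearMap.mem_ker.mp (h ▸ Submodule.mem_top : v ∈ LinearMap.ker (M.genAction i))
  · refine hirr.surjective_of_range (fun h => hv (LinearMap.congr_fun h v)) fun j w => ?_
    refine ⟨(q i j : K) • M.genAction j w, ?_⟩
    rw [map_smul]
    exact (M.genAction_skew i j w).symm

theorem module_finite [IsAlgClosed K] [Finite (paramGroup q)] (M : SimpleMod q) :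
    Module.Finite K M.carrier := by
  refine M.isIrreducibleFamily.module_finite (c := fun i j => (q j i : K))
    (fun i j v => M.genAction_skew j i v) (m := Nat.card (paramGroup q)) Nat.card_pos
    fun i j => by rw [← Units.val_pow_eq_pow_val, pow_card_paramGroup, Units.val_one]

theorem dim_eq_rank (M : SimpleMod q) : M.dim = Module.rank K M.carrier := rfl

theorem nonempty_linearEquiv {M N : SimpleMod q} (e : M.carrier ≃ₗ[K] N.carrier)
    (he : ∀ i v, e (M.genAction i v) = N.genAction i (e v)) : M ≈ N :=
  ⟨{ e with
      map_smul' := fun a v => QAffine.map_op_smul (e : M.carrier →ₗ[K] N.carrier) he a.unop v }⟩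

end SimpleMod

end AffineModules

/-! ### Dimension and classification by central characters -/

section Classification

variable {K : Type u} [Field K] {n : ℕ} {q q' : Matrix (Fin n) (Fin n) Kˣ}

theorem isBlockRep_genAction {s : ℕ} {ε : Fin s → Kˣ} {r : ℕ}
    (e : Fin n ≃ (Fin s × Fin 2) ⊕ Fin r) (hq' : ∀ a b, q' a b = blockParam ε r (e a) (e b))
    {V : Type*} [AddCommGroup V] [Module K V] (ρ : QTorus q' →ₐ[K] (Module.End K V)ᵐᵒᵖ) :
    IsBlockRep ε fun p => QTorus.genAction ρ (e.symm p) := by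
  refine ⟨fun p p' v => ?_, fun p => (QTorus.genAction_bijective ρ _).1⟩
  rw [QTorus.genAction_skew, hq', Equiv.apply_symm_apply, Equiv.apply_symm_apply]

theorem IsIrreducibleFamily.comp_equiv {ι κ V : Type*} [AddCommGroup V] [Module K V]
    {T : ι → Module.End K V} (hT : IsIrreducibleFamily T) (e : κ ≃ ι) :
    IsIrreducibleFamily fun k => T (e k) :=
  ⟨hT.nontrivial, fun W hW => hT.eq_bot_or_eq_top W fun i => by simpa using hW (e.symm i)⟩

/-- The parameters of a block quantum torus, indexed by `Fin n`. -/
def blockMatrix {s : ℕ} (ε : Fin s → Kˣ) {r : ℕ} (e : Fin n ≃ (Fin s × Fin 2) ⊕ Fin r) :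
    Matrix (Fin n) (Fin n) Kˣ :=
  fun a b => blockParam ε r (e a) (e b)

attribute [local instance] SimpleMod.moduleBase

variable [IsAlgClosed K] [Finite (paramGroup q)] {s : ℕ} {ε : Fin s → Kˣ} {r : ℕ}
  {e : Fin n ≃ (Fin s × Fin 2) ⊕ Fin r}

theorem SimpleMod.exists_isBlockRep (φ : QTorus q ≃ₐ[K] QTorus (blockMatrix ε e))
    (M : SimpleMod q) :
    ∃ ρ : QTorus q →ₐ[K] (Module.End K M.carrier)ᵐᵒᵖ, QTorus.genAction ρ = M.genAction ∧
      IsBlockRep ε (fun p => QTorus.genAction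
        (ρ.comp (φ.symm : QTorus (blockMatrix ε e) →ₐ[K] QTorus q)) (e.symm p)) ∧
      IsIrreducibleFamily (fun p => QTorus.genAction
        (ρ.comp (φ.symm : QTorus (blockMatrix ε e) →ₐ[K] QTorus q)) (e.symm p)) := by
  have := M.module_finite
  obtain ⟨ρ, hρ⟩ := exists_genAction_eq M.genAction_skew M.genAction_bijective
  refine ⟨ρ, hρ, isBlockRep_genAction e (fun _ _ => rfl) _, ?_⟩
  exact (QTorus.isIrreducibleFamily_comp (hρ ▸ M.isIrreducibleFamily) φ).comp_equiv e.symm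

theorem SimpleMod.dim_eq_prod (φ : QTorus q ≃ₐ[K] QTorus (blockMatrix ε e))
    (hk : ∀ i, 0 < orderOf (ε i)) (M : SimpleMod q) :
    M.dim = ((∏ i, orderOf (ε i) : ℕ) : Cardinal.{u}) := by
  have := M.module_finite
  obtain ⟨ρ, -, hblock, hirr⟩ := M.exists_isBlockRep φ
  rw [M.dim_eq_rank, ← Module.finrank_eq_rank, hblock.finrank_eq hirr hk]

/-- A complete invariant of simple modules on which no variable acts as zero. -/
theorem exists_injective_simpleClass (φ : QTorus q ≃ₐ[K] QTorus (blockMatrix ε e))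
    (hk : ∀ i, 0 < orderOf (ε i)) :
    ∃ f : SimpleClass q → Fin n → Kˣ, Function.Injective f := by
  have h : ∀ M : SimpleMod q, ∃ (θ : (Fin s × Fin 2) ⊕ Fin r → Kˣ)
      (ρ : QTorus q →ₐ[K] (Module.End K M.carrier)ᵐᵒᵖ), QTorus.genAction ρ = M.genAction ∧
      IsBlockRep ε (fun p => QTorus.genAction
        (ρ.comp (φ.symm : QTorus (blockMatrix ε e) →ₐ[K] QTorus q)) (e.symm p)) ∧
      IsIrreducibleFamily (fun p => QTorus.genAction
        (ρ.comp (φ.symm : QTorus (blockMatrix ε e) →ₐ[K] QTorus q)) (e.symm p)) ∧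
      HasCentralChar ε (fun p => QTorus.genAction
        (ρ.comp (φ.symm : QTorus (blockMatrix ε e) →ₐ[K] QTorus q)) (e.symm p)) θ := by
    intro M
    have := M.module_finite
    obtain ⟨ρ, hρ, hblock, hirr⟩ := M.exists_isBlockRep φ
    obtain ⟨θ, hθ⟩ := hblock.exists_hasCentralChar hirr
    exact ⟨θ, ρ, hρ, hblock, hirr, hθ⟩
  choose θ hθ using h
  -- The invariant is the central character of a chosen representative of each class, so
  -- independence of the representative need not be checked.
  refine ⟨fun c a => θ c.out (e a), fun c c' hcc => ?_⟩
  have hθeq : θ c.out = θ c'.out := by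
    funext p
    simpa using congrFun hcc (e.symm p)
  have := c.out.module_finite
  have := c'.out.module_finite
  obtain ⟨ρ, hρ, hblock, hirr, hchar⟩ := hθ c.out
  obtain ⟨ρ', hρ', hblock', hirr', hchar'⟩ := hθ c'.out
  rw [← hθeq] at hchar'
  obtain ⟨l, hl⟩ := hblock.exists_linearEquiv hirr hblock' hirr' hk hchar hchar'
  rw [← c.out_eq, ← c'.out_eq]
  refine Quotient.sound (SimpleMod.nonempty_linearEquiv l fun i v => ?_)
  -- The isomorphism intertwines the block generators, hence the whole torus, in particular the
  -- images `φ (x i)` of the original variables.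
  have := QTorus.apply_eq_of_genAction_eq
    (ρ := ρ.comp (φ.symm : QTorus (blockMatrix ε e) →ₐ[K] QTorus q))
    (ρ' := ρ'.comp (φ.symm : QTorus (blockMatrix ε e) →ₐ[K] QTorus q)) l
    (fun a v => by simpa using hl (e a) v) (φ (QTorus.x q i)) v
  rw [← hρ, ← hρ']
  simpa [QTorus.genAction] using this

end Classification

/-! ### A simple module from weighted shifts -/

section Existence

variable {K : Type u} [Field K] {n : ℕ} {q : Matrix (Fin n) (Fin n) Kˣ}

/-- The universal property of quantum affine space. -/
noncomputable def QAffine.lift {A : Type*} [Semiring A] [Algebra K A] (w : Fin n → A)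
    (h : ∀ i j, w i * w j = (q i j : K) • (w j * w i)) : QAffine q →ₐ[K] A :=
  RingQuot.liftAlgHom K ⟨FreeAlgebra.lift K w, by
    rintro _ _ ⟨i, j⟩
    simpa using h i j⟩

@[simp]
theorem QAffine.lift_x {A : Type*} [Semiring A] [Algebra K A] (w : Fin n → A)
    (h : ∀ i j, w i * w j = (q i j : K) • (w j * w i)) (i : Fin n) :
    QAffine.lift w h (QAffine.x q i) = w i := by
  simp [QAffine.lift, QAffine.x]

section Shift

variable {m : ℕ} [NeZero m] (hm : ∀ i j, (q i j : K) ^ m = 1)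

/-- The weights of the shift operators. -/
noncomputable def shiftWeight (i : Fin n) (a : Fin n → ZMod m) : K :=
  ∏ k, if k < i then AddChar.zmodChar m (hm i k) (a k) else 1

theorem shiftWeight_ne_zero (i : Fin n) (a : Fin n → ZMod m) : shiftWeight hm i a ≠ 0 := by
  refine Finset.prod_ne_zero_iff.mpr fun k _ => ?_
  split_ifs
  · rw [AddChar.zmodChar_apply]
    exact pow_ne_zero _ (q i k).ne_zero
  · exact one_ne_zero

theorem shiftWeight_add_single (i j : Fin n) (a : Fin n → ZMod m) :
    shiftWeight hm i (a + Pi.single j 1) =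
      shiftWeight hm i a * if j < i then (q i j : K) else 1 := by
  have h : ∀ k, (if k < i then
        AddChar.zmodChar m (hm i k) (a k + (Pi.single j 1 : Fin n → ZMod m) k) else 1) =
      (if k < i then AddChar.zmodChar m (hm i k) (a k) else 1) *
        if k = j then (if j < i then (q i j : K) else 1) else 1 := by
    intro k
    by_cases hkj : k = j
    · subst hkj
      rw [if_pos rfl, Pi.single_eq_same]
      by_cases hki : k < i
      · rw [if_pos hki, if_pos hki, if_pos hki, AddChar.map_add_eq_mul]
        congr 1
        simpa using AddChar.zmodChar_apply' (hm i k) 1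
      · rw [if_neg hki, if_neg hki, if_neg hki, one_mul]
    · simp [hkj]
  simp only [shiftWeight, Pi.add_apply, h, Finset.prod_mul_distrib, Finset.prod_ite_eq',
    Finset.mem_univ, if_true]

/-- The weighted shift operators on functions. -/
noncomputable def shiftOp (i : Fin n) : Module.End K ((Fin n → ZMod m) → K) where
  toFun f a := shiftWeight hm i a * f (a + Pi.single i 1)
  map_add' f g := by funext a; simp [mul_add]
  map_smul' c f := by funext a; simp [mul_left_comm]

theorem shiftOp_injective (i : Fin n) : Function.Injective (shiftOp hm i) := by
  intro f g h
  funext a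
  have := congrFun h (a - Pi.single i 1)
  simpa [shiftOp, shiftWeight_ne_zero] using this

/-- The weight of an operator depends only on the coordinates below its own index. Interchanging two
shifts thus changes only the weight of the larger index, by exactly the required parameter. -/
theorem shiftOp_skew (hq : IsMulAntisymm q) (i j : Fin n) :
    shiftOp hm j * shiftOp hm i = (q i j : K) • (shiftOp hm i * shiftOp hm j) := by
  refine LinearMap.ext fun f => funext fun a => ?_
  simp only [Module.End.mul_apply, LinearMap.smul_apply, Pi.smul_apply, smul_eq_mul, shiftOp,
    LinearMap.coe_mk, AddHom.coe_mk, shiftWeight_add_single]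
  rw [add_right_comm a (Pi.single i 1)]
  rcases lt_trichotomy i j with h | h | h
  · have hij : (q i j : K) * (q j i : K) = 1 := by
      rw [hq.2 i j]
      exact Units.mul_inv _
    rw [if_neg h.not_gt, if_pos h]
    linear_combination (-(shiftWeight hm i a * shiftWeight hm j a *
      f (a + Pi.single j 1 + Pi.single i 1))) * hij
  · subst h
    simp [hq.1]
  · rw [if_neg h.not_gt, if_pos h]
    ring

end Shift

/-- The functions on the finite group of exponents modulo `m` form a finite-dimensional module,
which contains a simple submodule; the shifts are injective, so no variable acts as zero on it. -/
theorem nonempty_simpleMod [Finite (paramGroup q)] (hq : IsMulAntisymm q) :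
    Nonempty (SimpleMod q) := by
  have : NeZero (Nat.card (paramGroup q)) := ⟨Nat.card_pos.ne'⟩
  have hm : ∀ i j, (q i j : K) ^ Nat.card (paramGroup q) = 1 := fun i j => by
    rw [← Units.val_pow_eq_pow_val, pow_card_paramGroup, Units.val_one]
  let V := (Fin n → ZMod (Nat.card (paramGroup q))) → K
  let ρ : QAffine q →ₐ[K] (Module.End K V)ᵐᵒᵖ :=
    QAffine.lift (fun i => MulOpposite.op (shiftOp hm i)) fun i j =>
      MulOpposite.unop_injective (shiftOp_skew hm hq i j)
  let σ : (QAffine q)ᵐᵒᵖ →ₐ[K] Module.End K V := AlgHom.opComm ρ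
  let _ : Module (QAffine q)ᵐᵒᵖ V := Module.compHom V (σ : (QAffine q)ᵐᵒᵖ →+* Module.End K V)
  have hsmul : ∀ (b : (QAffine q)ᵐᵒᵖ) (v : V), b • v = σ b v := fun _ _ => rfl
  have : IsScalarTower K (QAffine q)ᵐᵒᵖ V := ⟨fun c b v => by
    rw [hsmul, hsmul, map_smul, LinearMap.smul_apply]⟩
  have hx : ∀ i (v : V), MulOpposite.op (QAffine.x q i) • v = shiftOp hm i v := fun i v => by
    rw [hsmul]
    simp [σ, ρ, AlgHom.opComm]
  have : IsArtinian (QAffine q)ᵐᵒᵖ V := isArtinian_of_tower K inferInstance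
  obtain ⟨N, hN, -⟩ := (eq_bot_or_exists_atom_le (⊤ : Submodule (QAffine q)ᵐᵒᵖ V)).resolve_left
    top_ne_bot
  have hsimple := isSimpleModule_iff_isAtom.mpr hN
  have : Nontrivial N := IsSimpleModule.nontrivial (QAffine q)ᵐᵒᵖ N
  obtain ⟨v, hv⟩ := exists_ne (0 : N)
  refine ⟨⟨N, hsimple, fun i => ⟨v, fun h => hv (Subtype.ext ?_)⟩⟩⟩
  have h1 : shiftOp hm i (v : V) = 0 := (hx i v).symm.trans (congrArg Subtype.val h)
  exact shiftOp_injective hm i (h1.trans (map_zero _).symm)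

end Existence

/-! ### Orders of the parameters in a normal form -/

section NormalFormDimension

variable {K : Type u} [Field K] {n : ℕ} {q : Matrix (Fin n) (Fin n) Kˣ}

theorem IsNormalForm.exists_algEquiv_blockMatrix [Finite (paramGroup q)] {g : Kˣ}
    (hg : Subgroup.zpowers g = paramGroup q) {s : ℕ} {h : Fin s → ℕ} {z : ℕ}
    (H : IsNormalForm q g s h z) :
    ∃ e : Fin n ≃ (Fin s × Fin 2) ⊕ Fin (n - 2 * s),
      Nonempty (QTorus q ≃ₐ[K] QTorus (blockMatrix (fun i => g ^ normalExp n h z i) e)) ∧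
      ∀ i, 0 < orderOf (g ^ normalExp n h z i) ∧
        orderOf (g ^ normalExp n h z i) = Nat.card (paramGroup q) / h i := by
  have hle := H.two_mul_le
  have hm : Nat.card (paramGroup q) = orderOf g := by rw [← hg, Nat.card_zpowers]
  have hpos : 0 < orderOf g := hm ▸ Nat.card_pos
  -- Any bijection will do, since the block matrix is transported along it.
  let e : Fin n ≃ (Fin s × Fin 2) ⊕ Fin (n - 2 * s) := Fintype.equivOfCardEq (by
    simp only [Fintype.card_fin, Fintype.card_sum, Fintype.card_prod]
    omega)
  refine ⟨e, ⟨H.iso.some.trans (nonempty_algEquiv_blockTorus _ _ e fun _ _ => rfl).some.symm⟩,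
    fun i => ?_⟩
  have hdvd := hm ▸ H.dvd_card i
  have hh : h i ≠ 0 := fun h0 => hpos.ne' (zero_dvd_iff.mp (h0 ▸ hdvd))
  rw [H.order_eq, orderOf_pow_of_dvd hh hdvd, hm]
  exact ⟨Nat.div_pos (Nat.le_of_dvd hpos hdvd) (Nat.pos_of_ne_zero hh), rfl⟩

end NormalFormDimension

end QuantumSpace

theorem mainTheorem3 {K : Type u} [Field K] [IsAlgClosed K] {n : ℕ}
    (q : Matrix (Fin n) (Fin n) Kˣ) (hq : QuantumSpace.IsMulAntisymm q)
    (htors : IsMulTorsion (QuantumSpace.paramGroup q)) :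
    (∃ g : Kˣ, Subgroup.zpowers g = QuantumSpace.paramGroup q) ∧
    (∀ g : Kˣ, Subgroup.zpowers g = QuantumSpace.paramGroup q →
      ∃ (s : ℕ) (h : Fin s → ℕ) (z : ℕ), QuantumSpace.IsNormalForm q g s h z) ∧
    ∃ Ψ : (Fin n → Kˣ) → QuantumSpace.SimpleClass q,
      Function.Surjective Ψ ∧
      ∀ g : Kˣ, Subgroup.zpowers g = QuantumSpace.paramGroup q →
        ∀ (s : ℕ) (h : Fin s → ℕ) (z : ℕ), QuantumSpace.IsNormalForm q g s h z →
          ∀ α : Fin n → Kˣ, QuantumSpace.SimpleClass.dim (Ψ α) =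
            ((∏ i : Fin s, Nat.card (QuantumSpace.paramGroup q) / h i : ℕ) : Cardinal.{u}) := by
  have := QuantumSpace.paramGroup_finite htors
  obtain ⟨g, hg⟩ := QuantumSpace.exists_zpowers_eq_paramGroup (q := q)
  refine ⟨⟨g, hg⟩, fun g hg => QuantumSpace.exists_isNormalForm hq hg, ?_⟩
  obtain ⟨s, h, z, H⟩ := QuantumSpace.exists_isNormalForm hq hg
  obtain ⟨e, ⟨φ⟩, hk⟩ := H.exists_algEquiv_blockMatrix hg
  obtain ⟨f, hf⟩ := QuantumSpace.exists_injective_simpleClass φ fun i => (hk i).1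
  have : Nonempty (QuantumSpace.SimpleClass q) :=
    (QuantumSpace.nonempty_simpleMod hq).map (Quotient.mk _)
  -- The dimension formula is proved for every class and from whichever normal form is given, so it
  -- does not depend on the form used to build `f`.
  refine ⟨Function.invFun f, Function.invFun_surjective hf, fun g hg s h z H α => ?_⟩
  obtain ⟨e, ⟨φ⟩, hk⟩ := H.exists_algEquiv_blockMatrix hg
  induction Function.invFun f α using Quotient.inductionOn with
  | h M =>
    refine (M.dim_eq_prod φ fun i => (hk i).1).trans ?_
    exact congrArg _ (Finset.prod_congr rfl fun i _ => (hk i).2)
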